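/- Let $G$ be a finite group. A \emph{Beauville structure} for $G$ is a pair of triples $(x_1,y_1,z_1)$, $(x_2,y_2,z_2)$ of elements of $G$ such that, for $i=1,2$, the elements $x_i,y_i,z_i$ generate $G$ and have orders $l_i,m_i,n_i$, and (1) $x_iy_iz_i=1$ for $i=1,2$; (2) $l_i^{-1}+m_i^{-1}+n_i^{-1}<1$ for $i=1,2$; (3) no non-identity power of $x_1$, $y_1$ or $z_1$ is conjugate in $G$ to a power of $x_2$, $y_2$ or $z_2$. It is \emph{strongly real} if there are automorphisms $\alpha_1,\alpha_2$ of $G$, differing by an inner automorphism of $G$, such that for each $i=1,2$ the automorphism $\alpha_i$ inverts (at least) two of the elements $x_i,y_i,z_i$. \textbf{Theorem.} Let $q$ be a prime power, let $\mathbb F_q$ be the field with $q$ elements, and let $SL_2(q)$ be the group of $2\times 2$ matrices of determinant $1$ over $\mathbb F_q$. Then $SL_2(q)$ admits a Beauville structure if and only if $q>5$. Moreover, for every $q>5$ it admits a strongly real Beauville structure. -/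

import Mathlib

open scoped MatrixGroups

/-- A triple `(x, y, z)` of elements of a group. -/
structure GroupTriple (G : Type*) where
  x : G
  y : G
  z : G

namespace GroupTriple

variable {G : Type*}

/-- The set `{x, y, z}` of members of the triple. -/
def members (t : GroupTriple G) : Set G := {t.x, t.y, t.z}

/-- The triple generates the group. -/
def Generates [Group G] (t : GroupTriple G) : Prop := Subgroup.closure t.members = ⊤

/-- The hyperbolicity condition `1/l + 1/m + 1/n < 1` on the orders `l, m, n` of `x, y, z`
(used for finite groups, where all orders are positive). -/
def IsHyperbolic [Group G] (t : GroupTriple G) : Prop :=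
  (orderOf t.x : ℚ)⁻¹ + (orderOf t.y : ℚ)⁻¹ + (orderOf t.z : ℚ)⁻¹ < 1

/-- The automorphism `α` inverts (at least) two of the three terms of the triple. -/
def TwoInvertedBy [Group G] (t : GroupTriple G) (α : G ≃* G) : Prop :=
  (α t.x = t.x⁻¹ ∧ α t.y = t.y⁻¹) ∨
  (α t.y = t.y⁻¹ ∧ α t.z = t.z⁻¹) ∨
  (α t.x = t.x⁻¹ ∧ α t.z = t.z⁻¹)

end GroupTriple

/-- The triples `t₁`, `t₂` form an (unmixed) Beauville structure for the finite group `G`. -/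
structure IsBeauvilleStructure {G : Type*} [Group G] (t₁ t₂ : GroupTriple G) : Prop where
  generates₁ : t₁.Generates
  generates₂ : t₂.Generates
  mul_eq_one₁ : t₁.x * t₁.y * t₁.z = 1
  mul_eq_one₂ : t₂.x * t₂.y * t₂.z = 1
  hyperbolic₁ : t₁.IsHyperbolic
  hyperbolic₂ : t₂.IsHyperbolic
  /-- No non-identity power of a member of `t₁` is conjugate in `G` to a power of a member
  of `t₂`. -/
  not_isConj : ∀ a ∈ t₁.members, ∀ b ∈ t₂.members, ∀ i j : ℤ, a ^ i ≠ 1 → ¬ IsConj (a ^ i) (b ^ j)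

/-- A Beauville structure is strongly real if there are automorphisms `α₁`, `α₂` of `G`, differing
by an inner automorphism, such that each `αᵢ` inverts two elements of the triple `tᵢ`. -/
structure IsStronglyRealBeauvilleStructure {G : Type*} [Group G] (t₁ t₂ : GroupTriple G) : Prop
    extends IsBeauvilleStructure t₁ t₂ where
  exists_automorphisms : ∃ α₁ α₂ : G ≃* G, (∃ g : G, ∀ h : G, α₂ h = g * α₁ h * g⁻¹) ∧
    t₁.TwoInvertedBy α₁ ∧ t₂.TwoInvertedBy α₂

/-- The group `G` admits a Beauville structure. -/
def AdmitsBeauvilleStructure (G : Type*) [Group G] : Prop :=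
  ∃ t₁ t₂ : GroupTriple G, IsBeauvilleStructure t₁ t₂

/-- The group `G` admits a strongly real Beauville structure. -/
def AdmitsStronglyRealBeauvilleStructure (G : Type*) [Group G] : Prop :=
  ∃ t₁ t₂ : GroupTriple G, IsStronglyRealBeauvilleStructure t₁ t₂

/-! Orders in SL_2(q) are read off traces: an element of trace t ≠ ±2 has order dividing q - 1 or q
+ 1, and for odd q the quadratic character of t² - 4 decides which. If all members of one triple
have exponent m, all members of the other exponent n, and m, n are coprime, then condition (3) is
automatic (`not_isConj_of_coprime`).

Apart from q = 9, all triples have the form (W^k, W^i u, (W^(k+i) u)⁻¹) with W a companion matrix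
and u a shear. Conjugation by diag(1, -1) followed by a suitable inner automorphism inverts the
first two members, so any two such triples have inverting automorphisms differing by an inner one,
and strong reality costs nothing (`admitsStronglyReal_of_companionTriples`).

Existence. For q even the exponents are q - 1 and q + 1. For q odd, q ≥ 23, let N be the one of q ±
1 divisible by 4 and 2m the other; the exponents are N and mp, p the characteristic. The second
triple contains two unipotents; the first comes from a pigeonhole argument on quadratic characters
(`exists_companionTriple`). The primes 7 to 19 use explicit traces and q = 9 explicit matrices.

Generation needs no classification of subgroups. For H containing W and u, the parameters of the
shears in H form a vector space over a subfield K. The norm form of F[W], evaluated on the H-orbit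
of the first basis vector, takes values in K ∪ Kθ for one θ. Counting points on the conic "norm = 1"
then forces K = F (`eq_top_of_containsTorus`), and the shears together with W generate everything.

Non-existence for q ≤ 5: for q = 2 all orders are at most 3, against hyperbolicity; for q = 3 both
triples have a member with the central element -1 as a power; for q = 4 both contain elements of
order 5, and the Sylow 5-subgroups are cyclic of order 5 and conjugate. For q = 5 both ideas combine
with the Fricke identity, which constrains the traces of a generating pair (`fricke_ne_zero`). -/

namespace SpecialLinearTwo

/-! ### Traces and powers of 2 × 2 matrices of determinant one. -/

variable {F : Type*} [Field F]

/-- The companion matrix of `X ^ 2 - a X + 1`. -/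
def companion (a : F) : SL(2, F) := ⟨!![0, -1; 1, a], by simp⟩

/-- The upper unitriangular matrix with off-diagonal entry `l`. -/
def shear (l : F) : SL(2, F) := ⟨!![1, l; 0, 1], by simp⟩

/-- The trace of an element of `SL(2, F)`. -/
def tr (A : SL(2, F)) : F := A 0 0 + A 1 1

@[simp] lemma coe_companion (a : F) :
    (companion a : Matrix (Fin 2) (Fin 2) F) = !![0, -1; 1, a] := rfl

@[simp] lemma coe_shear (l : F) : (shear l : Matrix (Fin 2) (Fin 2) F) = !![1, l; 0, 1] := rfl

@[simp] lemma tr_companion (a : F) : tr (companion a) = a := by simp [tr]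

@[simp] lemma tr_shear (l : F) : tr (shear l) = 2 := by simp [tr]; norm_num

lemma det_eq_one (A : SL(2, F)) : A 0 0 * A 1 1 - A 0 1 * A 1 0 = 1 := by
  have h := A.det_coe
  rwa [Matrix.det_fin_two] at h

lemma ext_entries {A B : SL(2, F)} (h₁ : A 0 0 = B 0 0) (h₂ : A 0 1 = B 0 1)
    (h₃ : A 1 0 = B 1 0) (h₄ : A 1 1 = B 1 1) : A = B := by
  ext i j
  fin_cases i <;> fin_cases j <;> assumption

lemma mul_apply_two (A B : SL(2, F)) (i j : Fin 2) :
    (A * B) i j = A i 0 * B 0 j + A i 1 * B 1 j := by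
  simp [Matrix.mul_apply, Fin.sum_univ_two]

lemma inv_entries (A : SL(2, F)) :
    A⁻¹ 0 0 = A 1 1 ∧ A⁻¹ 0 1 = -A 0 1 ∧ A⁻¹ 1 0 = -A 1 0 ∧ A⁻¹ 1 1 = A 0 0 := by
  simp [Matrix.adjugate_fin_two]

lemma one_entries :
    (1 : SL(2, F)) 0 0 = 1 ∧ (1 : SL(2, F)) 0 1 = 0 ∧ (1 : SL(2, F)) 1 0 = 0 ∧
      (1 : SL(2, F)) 1 1 = 1 := by
  simp

@[simp] lemma tr_inv (A : SL(2, F)) : tr A⁻¹ = tr A := by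
  obtain ⟨h₁, -, -, h₂⟩ := inv_entries A
  rw [tr, h₁, h₂, tr, add_comm]

lemma tr_mul_comm (A B : SL(2, F)) : tr (A * B) = tr (B * A) := by
  simp only [tr, mul_apply_two]; ring

lemma companion_mul_shear (a l : F) : companion a * shear l = companion (a + l) := by
  apply ext_entries <;> simp [mul_apply_two, add_comm]

lemma shear_mul_shear (l m : F) : shear l * shear m = shear (l + m) := by
  apply ext_entries <;> simp [mul_apply_two, add_comm]

@[simp] lemma shear_zero : shear (0 : F) = 1 := by
  apply ext_entries <;> simp

lemma shear_inv (l : F) : (shear l)⁻¹ = shear (-l) := by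
  rw [inv_eq_iff_mul_eq_one, shear_mul_shear, add_neg_cancel, shear_zero]

/-- Cayley-Hamilton for `SL(2, F)`. -/
lemma coe_mul_self (A : SL(2, F)) :
    (A : Matrix (Fin 2) (Fin 2) F) * A = tr A • (A : Matrix (Fin 2) (Fin 2) F) - 1 := by
  have h := det_eq_one A
  ext i j
  fin_cases i <;> fin_cases j <;>
    simp [Matrix.mul_apply, Fin.sum_univ_two, tr] <;>
    first
      | linear_combination (1 : F) * h
      | linear_combination (-1 : F) * h
      | ring1

lemma coe_mul_self_apply (A : SL(2, F)) (i j : Fin 2) :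
    (A * A) i j = tr A * A i j - (1 : SL(2, F)) i j := by
  have := congrFun (congrFun (coe_mul_self A) i) j
  simpa using this

section Powers

variable {K : Type*} [Field K] [Algebra F K]

/-- Powers of a matrix with eigenvalues `z`, `z⁻¹`. -/
lemma pow_formula (A : SL(2, F)) {z : K} (hz : z ≠ 0) (hA : algebraMap F K (tr A) = z + z⁻¹)
    (n : ℕ) (i j : Fin 2) :
    (z - z⁻¹) * algebraMap F K ((A ^ n) i j) =
      (z ^ n - (z⁻¹) ^ n) * algebraMap F K (A i j) -
        (z ^ n * z⁻¹ - (z⁻¹) ^ n * z) * algebraMap F K ((1 : SL(2, F)) i j) := by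
  induction n using Nat.twoStepInduction with
  | zero => simp; ring
  | one => simp [hz]
  | more n h₀ h₁ =>
    have key : (A ^ (n + 2)) i j = tr A * (A ^ (n + 1)) i j - (A ^ n) i j := by
      have e₀ := coe_mul_self_apply A
      have : A ^ (n + 2) = A ^ n * (A * A) := by rw [pow_add, pow_two]
      rw [this, mul_apply_two, e₀, e₀, pow_succ, mul_apply_two]
      obtain ⟨a, b, c, d⟩ := one_entries (F := F)
      fin_cases j <;> simp <;> ring
    have hzz : z * z⁻¹ = 1 := mul_inv_cancel₀ hz
    rw [key, map_sub, map_mul, hA]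
    generalize z⁻¹ = w at *
    generalize algebraMap F K ((A ^ n) i j) = X at *
    generalize algebraMap F K ((A ^ (n + 1)) i j) = Y at *
    generalize algebraMap F K (A i j) = P at *
    generalize algebraMap F K ((1 : SL(2, F)) i j) = Q at *
    rw [pow_succ, pow_succ] at h₁
    rw [pow_add, pow_add]
    generalize z ^ n = Z at *
    generalize w ^ n = W at *
    linear_combination (z + w) * h₁ - h₀ +
      ((Z - W) * P - (Z * w - W * z) * Q) * hzz

/-- Since z ≠ z⁻¹, the matrix is diagonalizable over K, so its order is that of z. -/
lemma pow_eq_one_of_root (A : SL(2, F)) {z : K} (hz : z ≠ 0)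
    (hA : algebraMap F K (tr A) = z + z⁻¹) (hz2 : z ≠ z⁻¹) {n : ℕ} (hn : z ^ n = 1) :
    A ^ n = 1 := by
  have hd : z - z⁻¹ ≠ 0 := sub_ne_zero.mpr hz2
  have h := fun i j ↦ pow_formula A hz hA n i j
  simp only [inv_pow, hn, inv_one, sub_self, zero_mul, one_mul, zero_sub] at h
  ext i j
  apply (algebraMap F K).injective
  apply mul_left_cancel₀ hd
  rw [h]; ring

end Powers

/-- Here (A - 1)² = 0, so Aⁿ = 1 + n(A - 1). -/
lemma unipotent_pow (A : SL(2, F)) (hA : tr A = 2) (n : ℕ) (i j : Fin 2) :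
    (A ^ n) i j = n * A i j - (n - 1) * (1 : SL(2, F)) i j := by
  induction n using Nat.twoStepInduction with
  | zero => simp
  | one => simp
  | more n h₀ h₁ =>
    have key : (A ^ (n + 2)) i j = tr A * (A ^ (n + 1)) i j - (A ^ n) i j := by
      have e₀ := coe_mul_self_apply A
      have : A ^ (n + 2) = A ^ n * (A * A) := by rw [pow_add, pow_two]
      rw [this, mul_apply_two, e₀, e₀, pow_succ, mul_apply_two]
      obtain ⟨a, b, c, d⟩ := one_entries (F := F)
      fin_cases j <;> simp <;> ring
    rw [key, h₀, h₁, hA]; push_cast; ring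

lemma unipotent_pow_char (A : SL(2, F)) (hA : tr A = 2) (p : ℕ) [CharP F p] : A ^ p = 1 := by
  ext i j
  rw [unipotent_pow A hA]
  simp

/-- In odd characteristic, the quadratic character of the discriminant determines which torus
contains a matrix. -/
lemma pow_of_discriminant [Finite F] {q : ℕ} (hq : Nat.card F = q) (hodd : Odd q)
    (A : SL(2, F)) {e : ℤ} (he : e = 1 ∨ e = -1)
    (hD : (tr A ^ 2 - 4) ^ ((q - 1) / 2) = (e : F)) :
    A ^ ((q : ℤ) - e) = 1 := by
  have := Fintype.ofFinite F
  obtain ⟨p, hp⟩ := CharP.exists F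
  obtain ⟨n, hpr, hn⟩ := FiniteField.card F p
  rw [Fintype.card_eq_nat_card, hq] at hn
  have : Fact p.Prime := ⟨hpr⟩
  have h2 : (2 : F) ≠ 0 := by
    have : p ≠ 2 := by
      rintro rfl
      rw [hn, Nat.odd_pow_iff (by simp)] at hodd
      revert hodd; decide
    exact Ring.two_ne_zero (by rwa [← ringChar.eq F p] at this)
  let M : Matrix (Fin 2) (Fin 2) F := A
  let S : F → Matrix (Fin 2) (Fin 2) F := fun c ↦ algebraMap F _ c
  have hcard : ∀ c : F, c ^ q = c := fun c ↦ by
    have := FiniteField.pow_card c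
    rwa [Fintype.card_eq_nat_card, hq] at this
  obtain ⟨h, rfl⟩ := hodd
  have hS : ∀ c N, Commute (S c) N := fun c N ↦ Algebra.commutes c N
  have hSq : ∀ c, S c ^ (2 * h + 1) = S c := fun c ↦ by
    simp only [S]; rw [← map_pow, hcard]
  -- B = 2M - tr A satisfies B² = (tr A)² - 4, a scalar. Its q-th power is computed twice: by
  -- Frobenius it is 2M^q - tr A, and as B · (B²)^((q-1)/2) it is eB. Comparing gives M^q = M for e
  -- = 1 and M^q = tr A - M = M⁻¹ for e = -1, with no eigenvalues needed.
  have hB : (S 2 * M - S (tr A)) ^ (2 * h + 1) = S 2 * M ^ (2 * h + 1) - S (tr A) := by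
    have hc : Commute (S 2 * M) (S (tr A)) := (hS _ _).symm
    have := sub_pow_char_pow_of_commute p (n := n) hc
    rw [← hn] at this
    rw [this, (hS 2 M).mul_pow, hSq, hSq]
  have hB2 : (S 2 * M - S (tr A)) ^ 2 = S (tr A ^ 2 - 4) := by
    have hch : M * M = S (tr A) * M - 1 := by
      rw [coe_mul_self, Algebra.smul_def]
    have h4 : S (tr A ^ 2 - 4) = S (tr A) * S (tr A) - S 2 * S 2 := by
      simp only [S]; rw [← map_mul, ← map_mul, ← map_sub]; congr 1; ring
    rw [h4, pow_two, sub_mul, mul_sub, mul_sub, mul_assoc, ← mul_assoc M, ← (hS 2 M).eq,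
      mul_assoc, hch, ← (hS (tr A) (S 2 * M)).eq]
    have h22 : S 2 = 1 + 1 := by simp only [S]; rw [map_ofNat, one_add_one_eq_two]
    rw [h22]; noncomm_ring
  have hB3 : (S 2 * M - S (tr A)) ^ (2 * h + 1) = S e * (S 2 * M - S (tr A)) := by
    have : (2 * h + 1 - 1) / 2 = h := by omega
    rw [this] at hD
    rw [pow_succ, pow_mul, hB2, ← hD]
    simp only [S]; rw [map_pow]
  have h22 : IsUnit (S 2) := (IsUnit.mk0 _ h2).map (algebraMap F _)
  have hfin : S 2 * M ^ (2 * h + 1) = S (tr A) + S e * (S 2 * M - S (tr A)) := by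
    rw [← hB3, hB]; abel
  have hS1 : S 1 = 1 := map_one _
  have h11 : S 2 = 1 + 1 := by simp only [S]; rw [map_ofNat, one_add_one_eq_two]
  rcases he with rfl | rfl
  · have : M ^ (2 * h + 1) = M := by
      apply h22.mul_left_cancel
      rw [hfin]; push_cast; rw [hS1]; noncomm_ring
    have hA : A ^ (2 * h + 1) = A := Subtype.ext this
    rw [zpow_sub_one, zpow_natCast, hA, mul_inv_cancel]
  · have hinv : ((A⁻¹ : SL(2, F)) : Matrix (Fin 2) (Fin 2) F) = S (tr A) - M := by
      have : M * (S (tr A) - M) = 1 := by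
        rw [mul_sub, coe_mul_self, Algebra.smul_def, ← (hS (tr A) M).eq]; simp [S, M]
      calc _ = ((A⁻¹ : SL(2, F)) : Matrix (Fin 2) (Fin 2) F) * (M * (S (tr A) - M)) := by
            rw [this, mul_one]
        _ = _ := by
            rw [← mul_assoc, ← Matrix.SpecialLinearGroup.coe_mul, inv_mul_cancel]; simp
    have : M ^ (2 * h + 1) = S (tr A) - M := by
      apply h22.mul_left_cancel
      have hm : S ((-1 : ℤ) : F) = -1 := by simp [S]
      rw [hfin, hm, h11]; noncomm_ring
    have hA : A ^ (2 * h + 1) = A⁻¹ := Subtype.ext (by rw [hinv]; exact this)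
    rw [sub_neg_eq_add, zpow_add_one, zpow_natCast, hA, inv_mul_cancel]

end SpecialLinearTwo

/-! ### Orders, inverting automorphisms and companion triples. -/

namespace SpecialLinearTwo

variable {F : Type*} [Field F]

lemma sq_ne_one_of_tr {A : SL(2, F)} (h₁ : tr A ≠ 2) (h₂ : tr A ≠ -2) : A ^ 2 ≠ 1 := by
  intro h
  have e₀ := coe_mul_self_apply A 0 0
  have e₁ := coe_mul_self_apply A 1 1
  obtain ⟨o₁, -, -, o₂⟩ := one_entries (F := F)
  rw [← pow_two, h, o₁] at e₀
  rw [← pow_two, h, o₂] at e₁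
  have : (tr A - 2) * (tr A + 2) = 0 := by
    have ht : tr A = A 0 0 + A 1 1 := rfl
    linear_combination -e₀ - e₁ + tr A * ht
  rcases mul_eq_zero.mp this with h | h
  · exact h₁ (sub_eq_zero.mp h)
  · exact h₂ (eq_neg_of_add_eq_zero_left h)

lemma tr_one : tr (1 : SL(2, F)) = 2 := by simp [tr]; norm_num

lemma tr_sq (A : SL(2, F)) : tr (A ^ 2) = tr A ^ 2 - 2 := by
  have e₀ := coe_mul_self_apply A 0 0
  have e₁ := coe_mul_self_apply A 1 1
  obtain ⟨o₁, -, -, o₂⟩ := one_entries (F := F)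
  have ht : tr A = A 0 0 + A 1 1 := rfl
  rw [o₁] at e₀
  rw [o₂] at e₁
  have : tr (A ^ 2) = (A * A) 0 0 + (A * A) 1 1 := by rw [pow_two]; rfl
  rw [this, e₀, e₁]
  linear_combination (-tr A) * ht

lemma cube_ne_one_of_tr {A : SL(2, F)} (h₁ : tr A ≠ 2) (h₂ : tr A ≠ -1) : A ^ 3 ≠ 1 := by
  intro h
  have : A ^ 2 = A⁻¹ := eq_inv_of_mul_eq_one_left (by rw [← pow_succ, h])
  have h' := tr_sq A
  rw [this, tr_inv] at h'
  have : (tr A - 2) * (tr A + 1) = 0 := by linear_combination -h'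
  rcases mul_eq_zero.mp this with h | h
  · exact h₁ (sub_eq_zero.mp h)
  · exact h₂ (eq_neg_of_add_eq_zero_left h)

lemma three_le_orderOf {G : Type*} [Group G] [Finite G] {x : G} (h₁ : x ^ 2 ≠ 1) :
    3 ≤ orderOf x := by
  by_contra! h
  have h0 := orderOf_pos x
  apply h₁
  apply orderOf_dvd_iff_pow_eq_one.mp
  interval_cases orderOf x <;> decide

lemma four_le_orderOf {G : Type*} [Group G] [Finite G] {x : G} (h₁ : x ^ 2 ≠ 1)
    (h₂ : x ^ 3 ≠ 1) : 4 ≤ orderOf x := by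
  have h := three_le_orderOf h₁
  by_contra! h'
  exact h₂ (orderOf_dvd_iff_pow_eq_one.mp (by rw [show orderOf x = 3 by omega]))

lemma isHyperbolic_of_orders {G : Type*} [Group G] {t : GroupTriple G}
    (hx : 3 ≤ orderOf t.x) (hy : 3 ≤ orderOf t.y) (hz : 3 ≤ orderOf t.z)
    (h : 4 ≤ orderOf t.x ∨ 4 ≤ orderOf t.y ∨ 4 ≤ orderOf t.z) : t.IsHyperbolic := by
  have three : ∀ {n : ℕ}, 3 ≤ n → (n : ℚ)⁻¹ ≤ 3⁻¹ := fun {n} hn ↦ by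
    gcongr; exact_mod_cast hn
  have four : ∀ {n : ℕ}, 4 ≤ n → (n : ℚ)⁻¹ ≤ 4⁻¹ := fun {n} hn ↦ by
    gcongr; exact_mod_cast hn
  have := three hx
  have := three hy
  have := three hz
  rw [GroupTriple.IsHyperbolic]
  rcases h with h | h | h <;> have := four h <;> linarith

lemma orderOf_unipotent {A : SL(2, F)} (hA : tr A = 2) (h1 : A ≠ 1) (p : ℕ) [Fact p.Prime]
    [CharP F p] : orderOf A = p :=
  orderOf_eq_prime (unipotent_pow_char A hA p) h1

lemma shear_ne_one {l : F} (hl : l ≠ 0) : shear l ≠ 1 := by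
  intro h
  have := congrArg (fun A : SL(2, F) ↦ A 0 1) h
  simp at this
  exact hl this

lemma companion_ne_one (a : F) : companion a ≠ 1 := by
  intro h
  have := congrArg (fun A : SL(2, F) ↦ A 1 0) h
  simp at this

/-- Conjugation by `diag(1, -1)`, as a function. -/
def flipSigns (A : SL(2, F)) : SL(2, F) :=
  ⟨!![A 0 0, -A 0 1; -A 1 0, A 1 1], by
    rw [Matrix.det_fin_two_of, neg_mul_neg]; exact det_eq_one A⟩

lemma flipSigns_entries (A : SL(2, F)) :
    flipSigns A 0 0 = A 0 0 ∧ flipSigns A 0 1 = -A 0 1 ∧ flipSigns A 1 0 = -A 1 0 ∧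
      flipSigns A 1 1 = A 1 1 := ⟨rfl, rfl, rfl, rfl⟩

lemma flipSigns_flipSigns (A : SL(2, F)) : flipSigns (flipSigns A) = A := by
  obtain ⟨a, b, c, d⟩ := flipSigns_entries A
  obtain ⟨a', b', c', d'⟩ := flipSigns_entries (flipSigns A)
  apply ext_entries
  · rw [a', a]
  · rw [b', b, neg_neg]
  · rw [c', c, neg_neg]
  · rw [d', d]

lemma flipSigns_mul (A B : SL(2, F)) : flipSigns (A * B) = flipSigns A * flipSigns B := by
  obtain ⟨a, b, c, d⟩ := flipSigns_entries A
  obtain ⟨a', b', c', d'⟩ := flipSigns_entries B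
  obtain ⟨e, f, g, h⟩ := flipSigns_entries (A * B)
  apply ext_entries
  · rw [e, mul_apply_two, mul_apply_two, a, a', b, c']; ring
  · rw [f, mul_apply_two, mul_apply_two, a, b', b, d']; ring
  · rw [g, mul_apply_two, mul_apply_two, c, a', d, c']; ring
  · rw [h, mul_apply_two, mul_apply_two, c, b', d, d']; ring

/-- Conjugation by `diag(1, -1)`. -/
def reflect : SL(2, F) ≃* SL(2, F) where
  toFun := flipSigns
  invFun := flipSigns
  left_inv := flipSigns_flipSigns
  right_inv := flipSigns_flipSigns
  map_mul' := flipSigns_mul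

/-- The automorphism inverting `companion a` and all shears. -/
def invertAut (a : F) : SL(2, F) ≃* SL(2, F) := reflect.trans (MulAut.conj (shear (-a)))

lemma invertAut_apply (a : F) (A : SL(2, F)) :
    invertAut a A = shear (-a) * flipSigns A * (shear (-a))⁻¹ := rfl

lemma invertAut_shear (a l : F) : invertAut a (shear l) = (shear l)⁻¹ := by
  have : flipSigns (shear l) = shear (-l) := by apply ext_entries <;> simp [flipSigns]
  rw [invertAut_apply, this, shear_inv, shear_inv, shear_mul_shear, shear_mul_shear]
  congr 1; ring

lemma invertAut_companion (a : F) : invertAut a (companion a) = (companion a)⁻¹ := by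
  rw [invertAut_apply, shear_inv, neg_neg, mul_assoc, eq_inv_iff_mul_eq_one]
  obtain ⟨p, q, r, s⟩ := flipSigns_entries (companion a)
  apply ext_entries <;> simp only [mul_apply_two, p, q, r, s] <;> simp

/-- The triple `(W ^ k, W ^ i u, (W ^ (k + i) u)⁻¹)` with `W = companion a` and `u = shear l`. -/
def companionTriple (a l : F) (k i : ℤ) : GroupTriple SL(2, F) where
  x := companion a ^ k
  y := companion a ^ i * shear l
  z := (companion a ^ (k + i) * shear l)⁻¹

lemma companionTriple_mul (a l : F) (k i : ℤ) :
    (companionTriple a l k i).x * (companionTriple a l k i).y * (companionTriple a l k i).z = 1 := by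
  simp only [companionTriple, zpow_add]; group

/-- `invertAut a` sends W^i u to W^(-i) u⁻¹; conjugating by W^i turns this into u⁻¹ W^(-i) = (W^i
u)⁻¹ and leaves the powers of W alone. -/
lemma companionTriple_inverted (a l : F) (k i : ℤ) :
    (companionTriple a l k i).TwoInvertedBy
      ((invertAut a).trans (MulAut.conj (companion a ^ i))) := by
  left
  constructor <;>
    simp only [companionTriple, MulEquiv.trans_apply, MulAut.conj_apply, map_mul, map_zpow (invertAut a),
      invertAut_companion, invertAut_shear]
  · rw [inv_zpow, ← zpow_neg, ← zpow_add, ← zpow_neg, ← zpow_add]; congr 1; ring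
  · group

lemma companionTriple_generates {a l : F} {k i : ℤ}
    (hk : companion a ∈ Subgroup.zpowers (companion a ^ k))
    (hgen : ∀ H : Subgroup SL(2, F), companion a ∈ H → shear l ∈ H → H = ⊤) :
    (companionTriple a l k i).Generates := by
  set t := companionTriple a l k i with ht
  have hx : t.x ∈ Subgroup.closure t.members := Subgroup.subset_closure (by simp [GroupTriple.members])
  have hy : t.y ∈ Subgroup.closure t.members := Subgroup.subset_closure (by simp [GroupTriple.members])
  have hW : companion a ∈ Subgroup.closure t.members :=
    (Subgroup.zpowers_le.mpr hx) hk
  refine hgen _ hW ?_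
  have : shear l = (companion a ^ i)⁻¹ * t.y := by simp [ht, companionTriple]
  rw [this]
  exact mul_mem (inv_mem (zpow_mem hW i)) hy

lemma not_isConj_of_coprime {G : Type*} [Group G] {m n : ℕ} (hmn : m.Coprime n) {a b : G}
    (ha : a ^ m = 1) (hb : b ^ n = 1) (i j : ℤ) (h : a ^ i ≠ 1) : ¬ IsConj (a ^ i) (b ^ j) := by
  rintro hc
  have h₁ : (a ^ i) ^ m = 1 := by rw [← zpow_natCast, zpow_comm, zpow_natCast, ha, one_zpow]
  have h₂ : (b ^ j) ^ n = 1 := by rw [← zpow_natCast, zpow_comm, zpow_natCast, hb, one_zpow]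
  have h₃ : (a ^ i) ^ n = 1 := by
    have := hc.pow n
    rwa [h₂, isConj_one_left] at this
  exact h (by simpa [hmn] using pow_gcd_eq_one.mpr ⟨h₁, h₃⟩)

/-- A sufficient criterion for two companion triples to form a strongly real Beauville
structure. -/
lemma admitsStronglyReal_of_companionTriples {a₁ l₁ a₂ l₂ : F} {k₁ i₁ k₂ i₂ : ℤ} {m n : ℕ}
    (hmn : m.Coprime n)
    (hg₁ : (companionTriple a₁ l₁ k₁ i₁).Generates)
    (hg₂ : (companionTriple a₂ l₂ k₂ i₂).Generates)
    (hh₁ : (companionTriple a₁ l₁ k₁ i₁).IsHyperbolic)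
    (hh₂ : (companionTriple a₂ l₂ k₂ i₂).IsHyperbolic)
    (hm : ∀ g ∈ (companionTriple a₁ l₁ k₁ i₁).members, g ^ m = 1)
    (hn : ∀ g ∈ (companionTriple a₂ l₂ k₂ i₂).members, g ^ n = 1) :
    AdmitsStronglyRealBeauvilleStructure SL(2, F) := by
  refine ⟨_, _, ⟨⟨hg₁, hg₂, companionTriple_mul _ _ _ _, companionTriple_mul _ _ _ _, hh₁, hh₂,
    fun a ha b hb i j ↦ not_isConj_of_coprime hmn (hm a ha) (hn b hb) i j⟩, _, _, ?_,
    companionTriple_inverted _ _ _ _, companionTriple_inverted _ _ _ _⟩⟩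
  -- Both automorphisms are `flipSigns` followed by an inner one; this element undoes the first
  -- inner part and applies the second.
  refine ⟨companion a₂ ^ i₂ * shear (-a₂) * (shear (-a₁))⁻¹ * (companion a₁ ^ i₁)⁻¹, fun h ↦ ?_⟩
  simp only [MulEquiv.trans_apply, MulAut.conj_apply, invertAut_apply]
  group

end SpecialLinearTwo

/-! ### Subgroups containing a shear: multipliers and orbit norms. -/

namespace SpecialLinearTwo

variable {F : Type*} [Field F]

lemma companion_mul_shear_mul_companion_inv (a l : F) :
    companion a * shear l * (companion a)⁻¹ =
      Matrix.SpecialLinearGroup.transvection (one_ne_zero : (1 : Fin 2) ≠ 0) (-l) := by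
  rw [mul_inv_eq_iff_eq_mul]
  apply ext_entries <;> simp [mul_apply_two, Matrix.SpecialLinearGroup.transvection_coe,
    add_comm]

lemma eq_top_of_transvections {H : Subgroup SL(2, F)} (hs : ∀ l, shear l ∈ H)
    (ht : ∀ l, Matrix.SpecialLinearGroup.transvection (one_ne_zero : (1 : Fin 2) ≠ 0) l ∈ H) :
    H = ⊤ := by
  rw [eq_top_iff]
  intro A _
  refine Matrix.SL2.transvection_induction (· ∈ H) (fun i j hij c ↦ ?_)
    (fun A B ↦ mul_mem) A
  fin_cases i
  · obtain rfl : j = 1 := by fin_cases j <;> tauto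
    convert hs c using 1
    apply ext_entries <;> simp [Matrix.SpecialLinearGroup.transvection_coe]
  · obtain rfl : j = 0 := by fin_cases j <;> tauto
    exact ht c

/-- Conjugation by `companion a` carries the upper shears onto the lower ones, and transvections
generate. -/
lemma eq_top_of_shears {H : Subgroup SL(2, F)} (hs : ∀ l, shear l ∈ H) {a : F}
    (hW : companion a ∈ H) : H = ⊤ := by
  refine eq_top_of_transvections hs fun l ↦ ?_
  rw [← neg_neg l, ← companion_mul_shear_mul_companion_inv a]
  exact mul_mem (mul_mem hW (hs _)) (inv_mem hW)

/-- The additive group of parameters of the shears lying in a subgroup. -/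
def shearParams (H : Subgroup SL(2, F)) : AddSubgroup F where
  carrier := {l | shear l ∈ H}
  zero_mem' := by simp [one_mem]
  add_mem' {l m} hl hm := by
    rw [Set.mem_ofPred_eq, ← shear_mul_shear]; exact mul_mem hl hm
  neg_mem' {l} hl := by
    rw [Set.mem_ofPred_eq, ← shear_inv]; exact inv_mem hl

lemma mem_shearParams {H : Subgroup SL(2, F)} {l : F} : l ∈ shearParams H ↔ shear l ∈ H := Iff.rfl

lemma eq_top_of_card_prime (hp : (Nat.card F).Prime) {H : Subgroup SL(2, F)} {a l : F}
    (hW : companion a ∈ H) (hl : shear l ∈ H) (h0 : l ≠ 0) : H = ⊤ := by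
  have : Fact (Nat.card F).Prime := ⟨hp⟩
  have h : shearParams H = ⊤ := by
    refine ((shearParams H).eq_bot_or_eq_top_of_prime_card).resolve_left fun h ↦ h0 ?_
    have : l ∈ shearParams H := hl
    rwa [h, AddSubgroup.mem_bot] at this
  exact eq_top_of_shears (fun m ↦ by rw [← mem_shearParams, h]; trivial) hW

/-- The field of multipliers of an additive subgroup of a finite field. -/
def multiplierField [Finite F] (A : AddSubgroup F) : Subfield F where
  carrier := {c | ∀ x ∈ A, c * x ∈ A}
  mul_mem' {b c} hb hc x hx := by rw [mul_assoc]; exact hb _ (hc _ hx)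
  one_mem' x hx := by rwa [one_mul]
  add_mem' {b c} hb hc x hx := by rw [add_mul]; exact add_mem (hb _ hx) (hc _ hx)
  zero_mem' x hx := by rw [zero_mul]; exact zero_mem _
  neg_mem' {c} hc x hx := by rw [neg_mul]; exact neg_mem (hc _ hx)
  inv_mem' c hc x hx := by
    rcases eq_or_ne c 0 with rfl | h0
    · rw [inv_zero, zero_mul]; exact zero_mem _
    let f : A → A := fun y ↦ ⟨c * y, hc y y.2⟩
    have hf : Function.Injective f := fun y z h ↦ by
      simpa [f, h0] using h
    obtain ⟨y, hy⟩ := (Finite.injective_iff_surjective.mp hf) ⟨x, hx⟩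
    have : c * y = x := congrArg Subtype.val hy
    rw [← this, inv_mul_cancel_left₀ h0]
    exact y.2

lemma mem_multiplierField [Finite F] {A : AddSubgroup F} {c : F} :
    c ∈ multiplierField A ↔ ∀ x ∈ A, c * x ∈ A := Iff.rfl

/-- For t outside K, the elements 1 and t are independent over K, so K × K embeds in F. -/
lemma card_sq_le_of_ne_top [Finite F] {K : Subfield F} (hK : K ≠ ⊤) :
    Nat.card K ^ 2 ≤ Nat.card F := by
  obtain ⟨t, ht⟩ : ∃ t, t ∉ K := by
    by_contra! h
    exact hK (eq_top_iff.mpr fun x _ ↦ h x)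
  rw [pow_two, ← Nat.card_prod]
  refine Nat.card_le_card_of_injective (fun x : K × K ↦ (x.1 : F) + x.2 * t) ?_
  rintro ⟨x, y⟩ ⟨x', y'⟩ h
  have h' : (x : F) - x' = (y' - y) * t := by
    simp only at h; linear_combination h
  have hy : (y' : F) - y = 0 := by
    by_contra hne
    apply ht
    have : t = (x - x') * ((y' : F) - y)⁻¹ := by
      rw [h', mul_comm _ t, mul_assoc, mul_inv_cancel₀ hne, mul_one]
    rw [this]
    exact mul_mem (sub_mem x.2 x'.2) (inv_mem (sub_mem y'.2 y.2))
  rw [hy, zero_mul] at h'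
  ext
  · exact sub_eq_zero.mp h'
  · exact (sub_eq_zero.mp hy).symm

lemma sq_mem_multiplierField [Finite F] {H : Subgroup SL(2, F)} {g : SL(2, F)} (hg : g ∈ H)
    (h : g 1 0 = 0) : g 0 0 ^ 2 ∈ multiplierField (shearParams H) := by
  intro l hl
  have : shear (g 0 0 ^ 2 * l) = g * shear l * g⁻¹ := by
    rw [eq_mul_inv_iff_mul_eq]
    have hd := det_eq_one g
    apply ext_entries <;> simp [mul_apply_two, h]
    rw [h, mul_zero, sub_zero] at hd
    linear_combination g 0 0 * l * hd
  rw [mem_shearParams, this]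
  exact mul_mem (mul_mem hg hl) (inv_mem hg)

/-- The norm form preserved by `companion a`. -/
def normForm (a x y : F) : F := x ^ 2 + a * x * y + y ^ 2

/-- The values of the norm form on the `H`-orbit of the first basis vector. -/
def orbitNorms (a : F) (H : Subgroup SL(2, F)) : Set F :=
  {n | ∃ h ∈ H, normForm a (h 0 0) (h 1 0) = n}

/-- Up to sign, `H` contains all elements of determinant one in the algebra generated by
`companion a`. -/
def ContainsTorus (a : F) (H : Subgroup SL(2, F)) : Prop :=
  ∀ x y : F, normForm a x y = 1 → ∃ h ∈ H, ∃ e : F, e ^ 2 = 1 ∧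
    h 0 0 = e * x ∧ h 0 1 = -(e * y) ∧ h 1 0 = e * y ∧ h 1 1 = e * (x + a * y)

/-- Norm-one elements act transitively on vectors of equal nonzero norm. So some m in H takes the
first column of h' to ±1/c times that of h; then h⁻¹ m h' is upper triangular with corner ±1/c, and
conjugation by it scales shear parameters by c⁻². -/
lemma sq_mem_of_orbitNorms [Finite F] {a : F} {H : Subgroup SL(2, F)} (hT : ContainsTorus a H)
    {c n : F} (hc : c ≠ 0) (hn0 : n ≠ 0) (hn : n ∈ orbitNorms a H)
    (hcn : c ^ 2 * n ∈ orbitNorms a H) : c ^ 2 ∈ multiplierField (shearParams H) := by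
  obtain ⟨h', hh', hn'⟩ := hn
  obtain ⟨h, hh, hnc⟩ := hcn
  set p := h 0 0
  set r := h 1 0
  set p' := h' 0 0
  set r' := h' 1 0
  obtain ⟨m, hm, e, he, m₁, m₂, m₃, m₄⟩ :=
    -- With vectors (p, r) read as p + rW in F[W], these are the coordinates of the norm-one
    -- quotient (p + rW) / (c (p' + r'W)).
    hT ((p * p' + a * p * r' + r * r') / (c * n)) ((r * p' - p * r') / (c * n)) (by
      unfold normForm at *
      field_simp
      rw [← sub_eq_zero] at hn' hnc ⊢
      linear_combination c ^ 2 * n * hn' + (p' ^ 2 + a * p' * r' + r' ^ 2) * hnc)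
  obtain ⟨i₁, i₂, i₃, i₄⟩ := inv_entries h
  have hd := det_eq_one h
  have e₁ : (m * h') 0 0 = e * p / c := by
    rw [mul_apply_two, m₁, m₂]
    unfold normForm at *
    field_simp
    linear_combination e * p * hn'
  have e₂ : (m * h') 1 0 = e * r / c := by
    rw [mul_apply_two, m₃, m₄]
    unfold normForm at *
    field_simp
    linear_combination e * r * hn'
  have k₁ : (h⁻¹ * (m * h')) 1 0 = 0 := by
    rw [mul_apply_two, i₃, i₄, e₁, e₂]; ring
  have k₂ : (h⁻¹ * (m * h')) 0 0 = e / c := by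
    rw [mul_apply_two, i₁, i₂, e₁, e₂]
    linear_combination e / c * hd
  have := sq_mem_multiplierField (mul_mem (inv_mem hh) (mul_mem hm hh')) k₁
  rw [k₂, div_pow, he, one_div] at this
  rw [← inv_inv (c ^ 2)]
  exact inv_mem this

lemma one_mem_orbitNorms (a : F) (H : Subgroup SL(2, F)) : (1 : F) ∈ orbitNorms a H :=
  ⟨1, one_mem H, by simp [normForm]⟩

/-- The supply of orbit norms: up to sign, the torus moves the first basis vector to any point of
the conic, and a shear in H moves it off the conic. -/
lemma shear_mem_orbitNorms {a : F} {H : Subgroup SL(2, F)} (hT : ContainsTorus a H) {x y m : F}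
    (hxy : normForm a x y = 1) (hm : shear m ∈ H) : normForm a (x + m * y) y ∈ orbitNorms a H := by
  obtain ⟨h, hh, e, he, h₁, -, h₃, -⟩ := hT x y hxy
  refine ⟨shear m * h, mul_mem hm hh, ?_⟩
  rw [mul_apply_two, mul_apply_two, h₁, h₃]
  simp only [coe_shear, Matrix.of_apply, Matrix.cons_val', Matrix.cons_val_zero,
    Matrix.cons_val_one, Matrix.cons_val_fin_one, one_mul, zero_mul, zero_add]
  unfold normForm
  linear_combination ((x + m * y) ^ 2 + a * (x + m * y) * y + y ^ 2) * he

end SpecialLinearTwo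

/-! ### Point counts on the conic "norm = 1". -/

namespace SpecialLinearTwo

variable {F : Type*} [Field F]

lemma card_le_two_of_quadratic {s : Finset F} {A B C : F} (h : A ≠ 0 ∨ B ≠ 0 ∨ C ≠ 0)
    (hs : ∀ x ∈ s, A * x ^ 2 + B * x + C = 0) : s.card ≤ 2 := by
  by_contra! hc
  obtain ⟨x, y, z, hx, hy, hz, hxy, hxz, hyz⟩ := Finset.two_lt_card_iff.mp hc
  have hx := hs x hx
  have hy := hs y hy
  have hz := hs z hz
  have h₁ : A * (x + y) + B = 0 := by
    apply mul_left_cancel₀ (sub_ne_zero.mpr hxy); linear_combination hx - hy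
  have h₂ : A * (x + z) + B = 0 := by
    apply mul_left_cancel₀ (sub_ne_zero.mpr hxz); linear_combination hx - hz
  have hA : A = 0 := by
    apply mul_left_cancel₀ (sub_ne_zero.mpr hyz); linear_combination h₁ - h₂
  subst hA
  have hB : B = 0 := by simpa using h₁
  subst hB
  simp at h hx
  exact h hx

section Conic

variable [Fintype F] [DecidableEq F]

/-- The points of the conic `x ^ 2 + a x y + y ^ 2 = 1`. -/
def conic (a : F) : Finset (F × F) := Finset.univ.filter fun w ↦ normForm a w.1 w.2 = 1

lemma mem_conic {a : F} {w : F × F} : w ∈ conic a ↔ normForm a w.1 w.2 = 1 := by simp [conic]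

lemma card_conic_fiber_le (a : F) {s : Finset (F × F)} (hs : s ⊆ conic a) (y : F) :
    (s.filter fun w ↦ w.2 = y).card ≤ 2 := by
  have hinj : Set.InjOn Prod.fst ((s.filter fun w ↦ w.2 = y : Finset (F × F)) : Set (F × F)) := by
    intro w hw w' hw' h
    simp only [Finset.coe_filter, Set.mem_ofPred_eq] at hw hw'
    exact Prod.ext h (hw.2.trans hw'.2.symm)
  rw [← Finset.card_image_of_injOn hinj]
  refine card_le_two_of_quadratic (A := 1) (B := a * y) (C := y ^ 2 - 1) (Or.inl one_ne_zero) ?_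
  intro x hx
  obtain ⟨w, hw, rfl⟩ := Finset.mem_image.mp hx
  obtain ⟨hws, rfl⟩ := Finset.mem_filter.mp hw
  have := mem_conic.mp (hs hws)
  unfold normForm at this
  linear_combination this

lemma card_le_two_mul_card_image_snd (a : F) {s : Finset (F × F)} (hs : s ⊆ conic a) :
    s.card ≤ 2 * (s.image Prod.snd).card :=
  Finset.card_le_mul_card_image s 2 fun y _ ↦ card_conic_fiber_le a hs y

/-- Squaring is injective in characteristic two, so only the two choices of x for each y cost a
factor. -/
lemma card_conic_le_of_char_two {a d : F} (hd : d ≠ 0) {t : Finset F} (h2 : (2 : F) = 0)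
    (h : ∀ w ∈ conic a, 1 + d * w.2 ^ 2 ∈ t) : (conic a).card ≤ 2 * t.card := by
  refine (card_le_two_mul_card_image_snd a subset_rfl).trans (Nat.mul_le_mul_left 2 ?_)
  refine Finset.card_le_card_of_injOn (fun y ↦ 1 + d * y ^ 2) ?_ ?_
  · intro y hy
    obtain ⟨w, hw, rfl⟩ := Finset.mem_image.mp hy
    exact h w hw
  · intro y _ z _ hyz
    simp only [add_right_inj, mul_right_inj' hd] at hyz
    have : (y - z) ^ 2 = 0 := by linear_combination hyz + (z ^ 2 - y * z) * h2
    exact sub_eq_zero.mp (pow_eq_zero_iff two_ne_zero |>.mp this)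

lemma card_conic_le_of_sq_mem {a d : F} (hd : d ≠ 0) {t : Finset F}
    (h : ∀ w ∈ conic a, d * w.2 ^ 2 ∈ t) : (conic a).card ≤ 4 * t.card := by
  have h₁ := card_le_two_mul_card_image_snd a (subset_refl (conic a))
  have h₂ : ((conic a).image Prod.snd).card ≤ 2 * t.card := by
    refine Finset.card_le_mul_card_image_of_maps_to (f := fun y ↦ d * y ^ 2) ?_ 2 ?_
    · intro y hy
      obtain ⟨w, hw, rfl⟩ := Finset.mem_image.mp hy
      exact h w hw
    · intro k _
      refine card_le_two_of_quadratic (A := d) (B := 0) (C := -k) (Or.inl hd) fun y hy ↦ ?_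
      have := (Finset.mem_filter.mp hy).2
      linear_combination this
  omega

/-- The summand 2 bounds the points with y = 0. For y ≠ 0 the sheared norm n gives n - 1 = ly(2x +
(l + a)y), which determines x from y; eliminating x leaves a quadratic equation in y², hence at most
4 points for each n. -/
lemma card_conic_le_of_norm_mem {a l : F} (h2 : (2 : F) ≠ 0) (hl : l ≠ 0) {t : Finset F}
    (h : ∀ w ∈ conic a, normForm a (w.1 + l * w.2) w.2 ∈ t) : (conic a).card ≤ 2 + 4 * t.card := by
  have h₀ := card_conic_fiber_le a (subset_refl (conic a)) 0
  rw [← Finset.card_filter_add_card_filter_not (s := conic a) (fun w ↦ w.2 = 0)]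
  gcongr
  set s := (conic a).filter fun w ↦ ¬ w.2 = 0 with hsdef
  have hs : s ⊆ conic a := Finset.filter_subset _ _
  refine Finset.card_le_mul_card_image_of_maps_to
    (f := fun w ↦ normForm a (w.1 + l * w.2) w.2) (fun w hw ↦ h w (hs hw)) 4 fun n _ ↦ ?_
  set r := s.filter fun w ↦ normForm a (w.1 + l * w.2) w.2 = n with hrdef
  have key : ∀ w ∈ r, normForm a w.1 w.2 = 1 ∧ w.2 ≠ 0 ∧ 
      l * w.2 * (2 * w.1 + (l + a) * w.2) = n - 1 := by
    intro w hw
    obtain ⟨hws, hwn⟩ := Finset.mem_filter.mp hw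
    obtain ⟨hwc, hw0⟩ := Finset.mem_filter.mp hws
    have hwc := mem_conic.mp hwc
    refine ⟨hwc, hw0, ?_⟩
    unfold normForm at *
    linear_combination hwn - hwc
  have hr : (r.image fun w ↦ w.2 ^ 2).card ≤ 2 := by
    -- The quadratic in Y = y² is not identically zero: its constant term vanishes only for n = 1,
    -- and then the linear coefficient is -4l² ≠ 0.
    have hnz : ((l + a) ^ 2 - 2 * a * (l + a) + 4) * l ^ 2 ≠ 0 ∨
        (2 * a * (n - 1) * l - 2 * (n - 1) * (l + a) * l - 4 * l ^ 2) ≠ 0 ∨ (n - 1) ^ 2 ≠ 0 := by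
      by_contra! hc
      obtain ⟨-, hb, hc⟩ := hc
      have hn : n - 1 = 0 := by simpa using hc
      rw [hn] at hb
      have : (2 : F) ^ 2 * l ^ 2 = 0 := by linear_combination -hb
      simp [h2, hl] at this
    refine card_le_two_of_quadratic hnz fun Y hY ↦ ?_
    obtain ⟨w, hw, rfl⟩ := Finset.mem_image.mp hY
    obtain ⟨k₁, -, k₂⟩ := key w hw
    unfold normForm at k₁
    linear_combination 4 * l ^ 2 * w.2 ^ 2 * k₁ - (2 * l * w.1 * w.2 + (n - 1 - (l + a) * l * w.2 ^ 2) + 2 * a * l * w.2 ^ 2) * k₂ 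
  refine (Finset.card_le_mul_card_image (f := fun w ↦ w.2 ^ 2) r 2 fun Y _ ↦ ?_).trans (by omega)
  have hinj : Set.InjOn Prod.snd ((r.filter fun w ↦ w.2 ^ 2 = Y : Finset (F × F)) : Set (F × F)) := by
    intro w hw w' hw' hww
    simp only [Finset.coe_filter, Set.mem_ofPred_eq] at hw hw'
    obtain ⟨-, k₀, k₁⟩ := key w hw.1
    obtain ⟨-, -, k₂⟩ := key w' hw'.1
    refine Prod.ext ?_ hww
    rw [← hww] at k₂
    apply mul_left_cancel₀ (mul_ne_zero (mul_ne_zero hl k₀) h2)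
    linear_combination k₁ - k₂
  rw [← Finset.card_image_of_injOn hinj]
  refine card_le_two_of_quadratic (A := 1) (B := 0) (C := -Y) (Or.inl one_ne_zero) ?_
  intro y hy
  obtain ⟨w, hw, rfl⟩ := Finset.mem_image.mp hy
  have := (Finset.mem_filter.mp hw).2
  linear_combination this

end Conic

end SpecialLinearTwo

/-! ### The generation theorem. -/

namespace SpecialLinearTwo

variable {F : Type*} [Field F]

/-- Among four values, two lie in K or three lie in Kt. Two values in K and the value 1 at m = 0
determine the quadratic polynomial over K. Three values in Kt make it t times a polynomial over K;
its constant term 1 then forces t ∈ K. -/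
lemma sq_coeff_mem_of_values {K : Subfield F} {t P Q : F} {s : Finset F} (hs : ∀ m ∈ s, m ∈ K)
    (hs0 : ∀ m ∈ s, m ≠ 0) (hcard : 4 ≤ s.card)
    (hv : ∀ m ∈ s, 1 + m * P + m ^ 2 * Q ∈ K ∨ ∃ c ∈ K, 1 + m * P + m ^ 2 * Q = c * t) :
    Q ∈ K := by
  classical
  have two : ∀ m ∈ s, ∀ n ∈ s, m ≠ n → 1 + m * P + m ^ 2 * Q ∈ K → 1 + n * P + n ^ 2 * Q ∈ K →
      Q ∈ K := by
    intro m hm n hn hmn h₁ h₂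
    have hm0 := hs0 m hm
    have hn0 := hs0 n hn
    have hd := sub_ne_zero.mpr hmn
    have : Q = ((1 + m * P + m ^ 2 * Q - 1) / m - (1 + n * P + n ^ 2 * Q - 1) / n) / (m - n) := by
      field_simp; ring
    rw [this]
    exact div_mem (sub_mem (div_mem (sub_mem h₁ (one_mem K)) (hs m hm))
      (div_mem (sub_mem h₂ (one_mem K)) (hs n hn))) (sub_mem (hs m hm) (hs n hn))
  by_cases hone : 1 < (s.filter fun m ↦ 1 + m * P + m ^ 2 * Q ∈ K).card
  · obtain ⟨m, n, hm, hn, hmn⟩ := Finset.one_lt_card_iff.mp hone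
    rw [Finset.mem_filter] at hm hn
    exact two m hm.1 n hn.1 hmn hm.2 hn.2
  have hsplit := Finset.card_filter_add_card_filter_not (s := s)
    (fun m ↦ 1 + m * P + m ^ 2 * Q ∈ K)
  have htwo : 2 < (s.filter fun m ↦ ¬ 1 + m * P + m ^ 2 * Q ∈ K).card := by omega
  obtain ⟨m, n, r, hm, hn, hr, hmn, hmr, hnr⟩ := Finset.two_lt_card_iff.mp htwo
  rw [Finset.mem_filter] at hm hn hr
  obtain ⟨c, hc, ec⟩ := (hv m hm.1).resolve_left hm.2
  obtain ⟨d, hd, ed⟩ := (hv n hn.1).resolve_left hn.2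
  obtain ⟨e, he, ee⟩ := (hv r hr.1).resolve_left hr.2
  have m0 := hs m hm.1
  have n0 := hs n hn.1
  have r0 := hs r hr.1
  have hmn' := sub_ne_zero.mpr hmn
  have hmr' := sub_ne_zero.mpr hmr
  have hnr' := sub_ne_zero.mpr hnr
  have h₁ : P + (m + n) * Q = (c - d) / (m - n) * t := by
    field_simp; linear_combination ec - ed
  have h₂ : P + (m + r) * Q = (c - e) / (m - r) * t := by
    field_simp; linear_combination ec - ee
  have h₃ : Q = ((c - d) / (m - n) - (c - e) / (m - r)) / (n - r) * t := by
    rw [div_mul_eq_mul_div, sub_mul, ← h₁, ← h₂]; field_simp; ring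
  have hA : (c - d) / (m - n) ∈ K := div_mem (sub_mem hc hd) (sub_mem m0 n0)
  have hB : ((c - d) / (m - n) - (c - e) / (m - r)) / (n - r) ∈ K :=
    div_mem (sub_mem hA (div_mem (sub_mem hc he) (sub_mem m0 r0))) (sub_mem n0 r0)
  set A := (c - d) / (m - n)
  set B := ((c - d) / (m - n) - (c - e) / (m - r)) / (n - r)
  have h₄ : (1 : F) = (c - m * (A - (m + n) * B) - m ^ 2 * B) * t := by
    linear_combination ec - m * h₁ + (m * (m + n) - m ^ 2) * h₃
  have hu : c - m * (A - (m + n) * B) - m ^ 2 * B ∈ K :=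
    sub_mem (sub_mem hc (mul_mem m0 (sub_mem hA (mul_mem (add_mem m0 n0) hB))))
      (mul_mem (pow_mem m0 2) hB)
  have ht : t ∈ K := by
    have : t = (c - m * (A - (m + n) * B) - m ^ 2 * B)⁻¹ := eq_inv_of_mul_eq_one_right h₄.symm
    rw [this]; exact inv_mem hu
  rw [h₃]
  exact mul_mem hB ht

variable [Fintype F] [DecidableEq F]

/-- Compare a square orbit norm with the orbit norm 1, and a nonsquare one with a fixed nonsquare t:
each ratio is a square, so `sq_mem_of_orbitNorms` applies. -/
lemma exists_coset_of_orbitNorms {a : F} {H : Subgroup SL(2, F)} (hT : ContainsTorus a H) :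
    ∃ t : F, ∀ n ∈ orbitNorms a H, n ∈ multiplierField (shearParams H) ∨
      ∃ c ∈ multiplierField (shearParams H), n = c * t := by
  have sq : ∀ n ∈ orbitNorms a H, IsSquare n → n ∈ multiplierField (shearParams H) := by
    rintro _ hn ⟨c, rfl⟩
    rcases eq_or_ne c 0 with rfl | hc
    · rw [mul_zero]; exact zero_mem _
    · rw [← pow_two]
      exact sq_mem_of_orbitNorms hT hc one_ne_zero (one_mem_orbitNorms a H) (by
        rwa [mul_one, pow_two])
  by_cases h : ∃ t ∈ orbitNorms a H, ¬ IsSquare t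
  · obtain ⟨t, ht, hts⟩ := h
    refine ⟨t, fun n hn ↦ ?_⟩
    by_cases hns : IsSquare n
    · exact Or.inl (sq n hn hns)
    have h0 : t ≠ 0 := by rintro rfl; exact hts (IsSquare.zero)
    have h0' : n ≠ 0 := by rintro rfl; exact hns (IsSquare.zero)
    have hF : ringChar F ≠ 2 := fun h ↦ hts (FiniteField.isSquare_of_char_two h t)
    have hm : IsSquare (n * t) := by
      rw [← quadraticChar_one_iff_isSquare (mul_ne_zero h0' h0), map_mul,
        quadraticChar_neg_one_iff_not_isSquare.mpr hns,
        quadraticChar_neg_one_iff_not_isSquare.mpr hts]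
      norm_num
    obtain ⟨c, hc⟩ := hm
    have hc0 : c ≠ 0 := by
      rintro rfl
      exact mul_ne_zero h0' h0 (by rw [hc, mul_zero])
    have e : (c / t) ^ 2 * t = n := by
      field_simp; linear_combination -hc
    exact Or.inr ⟨_, sq_mem_of_orbitNorms hT (div_ne_zero hc0 h0) h0 ht (by rwa [e]), e.symm⟩
  · push Not at h
    exact ⟨0, fun n hn ↦ Or.inl (sq n hn (h n hn))⟩

/-- A subgroup of `SL(2, F)` containing a sufficiently large torus and a transvection outside the
normalizer of this torus is the whole group. -/
theorem eq_top_of_containsTorus {a l : F} {H : Subgroup SL(2, F)} (hq : 5 < Fintype.card F)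
    (h9 : Fintype.card F ≠ 9) (hT : ContainsTorus a H)
    (hC : Fintype.card F - 1 ≤ (conic a).card) (hl : l ≠ 0) (hl2 : (2 : F) = 0 → l + a ≠ 0)
    (hW : companion a ∈ H) (hs : shear l ∈ H) : H = ⊤ := by
  classical
  have hC' : Fintype.card F ≤ (conic a).card + 1 := by omega
  set K := multiplierField (shearParams H) with hKdef
  -- The shear parameters form a K-subspace containing l ≠ 0. The contradiction will come from |K|²
  -- ≤ q against an upper bound for the conic linear in |K|.
  suffices hK : K = ⊤ by
    refine eq_top_of_shears (fun m ↦ ?_) hW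
    have : m / l ∈ K := by rw [hK]; trivial
    have := mem_multiplierField.mp this l hs
    rwa [div_mul_cancel₀ _ hl] at this
  by_contra hK
  have hsq := card_sq_le_of_ne_top hK
  set t : Finset F := Finset.univ.filter (· ∈ K) with ht
  have htm : ∀ {x}, x ∈ t ↔ x ∈ K := by simp [ht]
  have hcard : Nat.card K = t.card := by
    rw [Nat.card_eq_fintype_card, ht, ← Fintype.card_subtype]
  have hpow : Fintype.card F = t.card ^ Module.finrank K F := by
    rw [← hcard, Nat.card_eq_fintype_card]
    exact Module.card_eq_pow_finrank
  rw [hcard, Nat.card_eq_fintype_card] at hsq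
  obtain ⟨θ, hθ⟩ := exists_coset_of_orbitNorms hT
  have hval : ∀ w ∈ conic a, ∀ m, shear m ∈ H → normForm a (w.1 + m * w.2) w.2 ∈ K ∨
      ∃ c ∈ K, normForm a (w.1 + m * w.2) w.2 = c * θ := fun w hw m hm ↦
    hθ _ (shear_mem_orbitNorms hT (mem_conic.mp hw) hm)
  by_cases h2 : (2 : F) = 0
  -- Every element is a square here, so all orbit norms lie in K. The coefficient l(l + a) must not
  -- vanish: `shear a` inverts `companion a` in characteristic two.
  · have h := card_conic_le_of_char_two (a := a) (mul_ne_zero hl (hl2 h2)) (t := t) h2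
      (fun w hw ↦ by
        have hw' := mem_conic.mp hw
        have e : 1 + l * (l + a) * w.2 ^ 2 = normForm a (w.1 + l * w.2) w.2 := by
          unfold normForm at *
          linear_combination -hw' - l * w.1 * w.2 * h2
        have hF : ringChar F = 2 := by
          have := CharTwo.of_one_ne_zero_of_two_eq_zero (R := F) one_ne_zero h2
          exact ringChar.eq F 2
        have hmem := shear_mem_orbitNorms hT hw' hs
        rw [htm, e]
        obtain ⟨c, hc⟩ := FiniteField.isSquare_of_char_two hF (normForm a (w.1 + l * w.2) w.2)
        rw [hc] at hmem ⊢
        rcases eq_or_ne c 0 with rfl | hc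
        · rw [mul_zero]; exact zero_mem _
        · rw [← pow_two]
          exact sq_mem_of_orbitNorms hT hc one_ne_zero (one_mem_orbitNorms a H) (by
            rwa [mul_one, pow_two]))
    have : t.card ≤ 2 := by
      by_contra! hc
      nlinarith [hC', h, hsq, hc]
    interval_cases t.card <;> omega
  have hF : ringChar F ≠ 2 := fun h ↦ h2 (by
    have := ringChar.Nat.cast_ringChar (R := F); rw [h] at this; exact_mod_cast this)
  have hodd : Odd (Fintype.card F) := Nat.odd_iff.mpr (FiniteField.odd_card_of_char_ne_two hF)
  have hd0 : Module.finrank K F ≠ 0 := by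
    intro h; rw [h, pow_zero] at hpow; omega
  have htodd : Odd t.card := by
    rw [hpow, Nat.odd_pow_iff hd0] at hodd; exact hodd
  have ht3 : 2 ≤ t.card := Finset.one_lt_card.mpr
    ⟨0, htm.mpr (zero_mem K), 1, htm.mpr (one_mem K), zero_ne_one⟩
  -- Interpolation needs four nonzero elements of K. For |K| = 3 the values are counted instead: K ∪
  -- Kθ has at most 5 elements, so the conic has at most 2 + 4 · 5 = 22 points, too few for q ≥ 27.
  -- Only q = 9 escapes.
  rcases (by obtain ⟨r, hr⟩ := htodd; omega : t.card = 3 ∨ 5 ≤ t.card) with h3 | h5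
  · have hV := card_conic_le_of_norm_mem (a := a) h2 hl (t := t ∪ (t.erase 0).image (· * θ))
      (fun w hw ↦ by
        rw [Finset.mem_union]
        rcases hval w hw l hs with h | ⟨c, hc, h⟩
        · exact Or.inl (htm.mpr h)
        · rcases eq_or_ne c 0 with rfl | hc0
          · left; rw [htm, h, zero_mul]; exact zero_mem K
          · right; rw [h]
            exact Finset.mem_image_of_mem _ (Finset.mem_erase.mpr ⟨hc0, htm.mpr hc⟩))
    have hVc : (t ∪ (t.erase 0).image (· * θ)).card ≤ 5 := by
      refine (Finset.card_union_le _ _).trans ?_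
      have := Finset.card_image_le (s := t.erase 0) (f := (· * θ))
      rw [Finset.card_erase_of_mem (htm.mpr (zero_mem K))] at this
      omega
    have h27 : 27 ≤ Fintype.card F := by
      rw [h3] at hpow
      have : 3 ≤ Module.finrank K F := by
        by_contra! hlt
        interval_cases Module.finrank K F <;> simp_all
      calc 27 = 3 ^ 3 := by norm_num
        _ ≤ _ := Nat.pow_le_pow_right (by norm_num) this
        _ = _ := hpow.symm
    omega
  · have h := card_conic_le_of_sq_mem (a := a) (d := l ^ 2) (pow_ne_zero 2 hl) (t := t)
      (fun w hw ↦ by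
        rw [htm]
        refine sq_coeff_mem_of_values (s := t.erase 0) (t := θ)
          (P := 2 * l * w.1 * w.2 + a * l * w.2 ^ 2)
          (fun m hm ↦ htm.mp (Finset.mem_of_mem_erase hm)) (fun m hm ↦ Finset.ne_of_mem_erase hm)
          (by rw [Finset.card_erase_of_mem (htm.mpr (zero_mem K))]; omega) (fun m hm ↦ ?_)
        have hmK := htm.mp (Finset.mem_of_mem_erase hm)
        have e : 1 + m * (2 * l * w.1 * w.2 + a * l * w.2 ^ 2) + m ^ 2 * (l ^ 2 * w.2 ^ 2) =
            normForm a (w.1 + m * l * w.2) w.2 := by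
          have hw' := mem_conic.mp hw
          unfold normForm at *
          linear_combination -hw'
        rw [e]
        exact hval w hw _ (mem_multiplierField.mp hmK l hs))
    nlinarith [hC', h, hsq, h5]

end SpecialLinearTwo

/-! ### Generators of the tori of order q - 1 and q + 1. -/

namespace SpecialLinearTwo

variable {F : Type*} [Field F] [Fintype F]

lemma algebraMap_pow_card (x : F) :
    algebraMap F (AlgebraicClosure F) x ^ Fintype.card F = algebraMap F (AlgebraicClosure F) x := by
  rw [← map_pow, FiniteField.pow_card]

lemma add_pow_card (x y : AlgebraicClosure F) :
    (x + y) ^ Fintype.card F = x ^ Fintype.card F + y ^ Fintype.card F := by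
  obtain ⟨p, hp⟩ := CharP.exists F
  obtain ⟨n, hpr, hn⟩ := FiniteField.card F p
  have : Fact p.Prime := ⟨hpr⟩
  have : CharP (AlgebraicClosure F) p := charP_of_injective_algebraMap (algebraMap F (AlgebraicClosure F)).injective p
  rw [hn, add_pow_char_pow]

/-- The elements of F already exhaust the q possible roots of X^q - X. -/
lemma exists_algebraMap_eq {c : (AlgebraicClosure F)} (hc : c ^ Fintype.card F = c) : ∃ a, algebraMap F (AlgebraicClosure F) a = c := by
  classical
  by_contra! h
  have hp := FiniteField.X_pow_card_sub_X_ne_zero (AlgebraicClosure F) (Fintype.one_lt_card (α := F))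
  have hdeg := FiniteField.X_pow_card_sub_X_natDegree_eq (AlgebraicClosure F) (Fintype.one_lt_card (α := F))
  have hcard := Polynomial.card_le_degree_of_subset_roots
    (Z := insert c (Finset.univ.image (algebraMap F (AlgebraicClosure F))))
    (p := Polynomial.X ^ Fintype.card F - Polynomial.X) (by
      intro x hx
      rw [Finset.mem_val, Finset.mem_insert] at hx
      rw [Polynomial.mem_roots hp]
      rcases hx with rfl | hx
      · simp [hc]
      · obtain ⟨y, -, rfl⟩ := Finset.mem_image.mp hx
        simp [algebraMap_pow_card])
  rw [Finset.card_insert_of_notMem (by simpa using h),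
    Finset.card_image_of_injective _ (algebraMap F (AlgebraicClosure F)).injective, Finset.card_univ, hdeg] at hcard
  omega

/-- `companion a` generates a maximal torus of order `N`, where `N` is `q - 1` or `q + 1`. -/
structure IsTorusGenerator (a : F) (N : ℕ) (z : AlgebraicClosure F) : Prop where
  order : N + 1 = Fintype.card F ∨ N = Fintype.card F + 1
  prim : IsPrimitiveRoot z N
  trace : algebraMap F (AlgebraicClosure F) a = z + z⁻¹

/-- N is ±1 in F, so a primitive N-th root z exists. The q-th power map sends z to z or z⁻¹, hence
fixes z + z⁻¹, which therefore lies in F. -/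
lemma exists_isTorusGenerator {N : ℕ} (hN : N + 1 = Fintype.card F ∨ N = Fintype.card F + 1) :
    ∃ (a : F) (z : AlgebraicClosure F), IsTorusGenerator a N z := by
  have hN0 : NeZero (N : F) := ⟨by
    have h0 : ((Fintype.card F : ℕ) : F) = 0 := Nat.cast_card_eq_zero F
    rcases hN with h | h
    · rw [← h] at h0; push_cast at h0
      rw [eq_neg_of_add_eq_zero_left h0]; simp
    · rw [h]; push_cast; simp [h0]⟩
  obtain ⟨z, hz⟩ := HasEnoughRootsOfUnity.exists_primitiveRoot (AlgebraicClosure F) N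
  obtain ⟨a, ha⟩ := exists_algebraMap_eq (c := z + z⁻¹) (by
    rw [add_pow_card, inv_pow]
    rcases hN with h | h
    · rw [← h, pow_succ, hz.pow_eq_one, one_mul]
    · have : z ^ Fintype.card F = z⁻¹ := eq_inv_of_mul_eq_one_left (by
        rw [← pow_succ, ← h, hz.pow_eq_one])
      rw [this, inv_inv, add_comm])
  exact ⟨a, z, hN, hz, ha⟩

namespace IsTorusGenerator

variable {a : F} {N : ℕ} {z : AlgebraicClosure F}

lemma ne_zero (h : IsTorusGenerator a N z) (hN : N ≠ 0) : z ≠ 0 := h.prim.ne_zero hN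

lemma ne_inv (h : IsTorusGenerator a N z) (hN : 3 ≤ N) : z ≠ z⁻¹ := by
  intro hz
  have hz0 := h.ne_zero (by omega)
  have : z ^ 2 = 1 := by rw [pow_two]; nth_rw 2 [hz]; exact mul_inv_cancel₀ hz0
  have := Nat.le_of_dvd (by norm_num) (h.prim.dvd_of_pow_eq_one 2 this)
  omega

lemma companion_pow_entries (h : IsTorusGenerator a N z) (hN : 3 ≤ N) (n : ℕ) :
    (z - z⁻¹) * algebraMap F (AlgebraicClosure F) ((companion a ^ n) 0 0) = z⁻¹ ^ n * z - z ^ n * z⁻¹ ∧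
    (z - z⁻¹) * algebraMap F (AlgebraicClosure F) ((companion a ^ n) 0 1) = -(z ^ n - z⁻¹ ^ n) ∧
    (z - z⁻¹) * algebraMap F (AlgebraicClosure F) ((companion a ^ n) 1 0) = z ^ n - z⁻¹ ^ n ∧
    (z - z⁻¹) * algebraMap F (AlgebraicClosure F) ((companion a ^ n) 1 1) =
      (z ^ n - z⁻¹ ^ n) * algebraMap F (AlgebraicClosure F) a + (z⁻¹ ^ n * z - z ^ n * z⁻¹) := by
  have hz0 := h.ne_zero (by omega)
  have key := pow_formula (companion a) hz0 (by rw [tr_companion]; exact h.trace) n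
  refine ⟨?_, ?_, ?_, ?_⟩ <;> rw [key] <;> simp
  ring

lemma pow_eq_one (h : IsTorusGenerator a N z) (hN : 3 ≤ N) : companion a ^ N = 1 :=
  pow_eq_one_of_root _ (h.ne_zero (by omega)) (by rw [tr_companion]; exact h.trace)
    (h.ne_inv hN) h.prim.pow_eq_one

lemma dvd_of_pow_eq_one (h : IsTorusGenerator a N z) (hN : 3 ≤ N) {n : ℕ} (hn : companion a ^ n = 1) : N ∣ n := by
  have hz0 := h.ne_zero (by omega)
  have hd := sub_ne_zero.mpr (h.ne_inv hN)
  obtain ⟨e₁, -, e₂, -⟩ := h.companion_pow_entries hN n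
  rw [hn] at e₁ e₂
  simp at e₁ e₂
  apply h.prim.dvd_of_pow_eq_one
  apply mul_left_cancel₀ hd
  have : (z ^ n)⁻¹ = z ^ n := (sub_eq_zero.mp e₂.symm).symm
  rw [this] at e₁
  linear_combination -e₁

/-- The eigenvalue x + yz of x + yW has N-th power 1: for N = q - 1 it is a nonzero element fixed by
Frobenius, and for N = q + 1 Frobenius takes it to x + yz⁻¹, its inverse. So it is a power of z, and
x + yW is that power of W. -/
lemma exists_pow (h : IsTorusGenerator a N z) (hN : 3 ≤ N) {x y : F} (hxy : normForm a x y = 1) :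
    ∃ n : ℕ, (companion a ^ n) 0 0 = x ∧ (companion a ^ n) 0 1 = -y ∧
      (companion a ^ n) 1 0 = y ∧ (companion a ^ n) 1 1 = x + a * y := by
  have hz0 := h.ne_zero (by omega)
  have hd := sub_ne_zero.mpr (h.ne_inv hN)
  have hzz : z * z⁻¹ = 1 := mul_inv_cancel₀ hz0
  set X := algebraMap F (AlgebraicClosure F) x with hX
  set Y := algebraMap F (AlgebraicClosure F) y with hY
  have hXY : (X + Y * z) * (X + Y * z⁻¹) = 1 := by
    have := congrArg (algebraMap F (AlgebraicClosure F)) hxy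
    rw [normForm] at this
    simp only [map_add, map_mul, map_pow, h.trace, ← hX, ← hY, map_one] at this
    linear_combination this + Y ^ 2 * hzz
  have hinv : (X + Y * z)⁻¹ = X + Y * z⁻¹ := inv_eq_of_mul_eq_one_right hXY
  have hne : X + Y * z ≠ 0 := left_ne_zero_of_mul_eq_one hXY
  have hq : (X + Y * z) ^ Fintype.card F = X + Y * z ^ Fintype.card F := by
    rw [add_pow_card, mul_pow, hX, hY, algebraMap_pow_card, algebraMap_pow_card]
  have hone : (X + Y * z) ^ N = 1 := by
    rcases h.order with hc | hc
    · have hzq : z ^ Fintype.card F = z := by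
        rw [← hc, pow_succ, h.prim.pow_eq_one, one_mul]
      rw [hzq, ← hc, pow_succ] at hq
      exact mul_right_cancel₀ hne (by rw [hq, one_mul])
    · have hzq : z ^ Fintype.card F = z⁻¹ := eq_inv_of_mul_eq_one_left (by
        rw [← pow_succ, ← hc, h.prim.pow_eq_one])
      rw [hzq, ← hinv] at hq
      rw [hc, pow_succ, hq, inv_mul_cancel₀ hne]
  have : NeZero N := ⟨by omega⟩
  obtain ⟨n, -, hn⟩ := h.prim.eq_pow_of_pow_eq_one hone
  obtain ⟨e₁, e₂, e₃, e₄⟩ := h.companion_pow_entries hN n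
  rw [inv_pow, hn, hinv] at e₁ e₂ e₃ e₄
  refine ⟨n, ?_, ?_, ?_, ?_⟩ <;> apply (algebraMap F (AlgebraicClosure F)).injective <;> apply mul_left_cancel₀ hd
  · rw [e₁]; linear_combination (-Y + Y) * hzz 
  · rw [e₂, map_neg]; ring
  · rw [e₃]; ring
  · rw [e₄, map_add, map_mul]; ring

lemma containsTorus (h : IsTorusGenerator a N z) (hN : 3 ≤ N) {H : Subgroup SL(2, F)} (hW : companion a ∈ H) :
    ContainsTorus a H := by
  intro x y hxy
  obtain ⟨n, h₁, h₂, h₃, h₄⟩ := h.exists_pow hN hxy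
  exact ⟨companion a ^ n, pow_mem hW n, 1, one_pow 2, by simpa using h₁, by simpa using h₂,
    by simpa using h₃, by simpa using h₄⟩

lemma le_card_conic (h : IsTorusGenerator a N z) [DecidableEq F] (hN : 3 ≤ N) : N ≤ (conic a).card := by
  have hform : ∀ n : ℕ, normForm a ((companion a ^ n) 0 0) ((companion a ^ n) 1 0) = 1 := by
    intro n
    induction n with
    | zero => simp [normForm]
    | succ k ih =>
      rw [pow_succ', mul_apply_two, mul_apply_two]
      simp only [normForm, coe_companion, Matrix.of_apply, Matrix.cons_val', Matrix.cons_val_zero,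
        Matrix.cons_val_one, Matrix.cons_val_fin_one] at *
      linear_combination ih
  have hdiv : ∀ m n : ℕ, m ≤ n → n < N → (companion a ^ m) 0 0 = (companion a ^ n) 0 0 →
      (companion a ^ m) 1 0 = (companion a ^ n) 1 0 → m = n := by
    intro m n hmn hn h₀ h₁
    have hd := sub_ne_zero.mpr (h.ne_inv hN)
    have : companion a ^ m = companion a ^ n := by
      obtain ⟨e₁, e₂, e₃, e₄⟩ := h.companion_pow_entries hN m
      obtain ⟨f₁, f₂, f₃, f₄⟩ := h.companion_pow_entries hN n
      rw [h₀, f₁] at e₁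
      rw [h₁, f₃] at e₃
      apply ext_entries _ _ h₁ _
      · exact h₀
      · apply (algebraMap F (AlgebraicClosure F)).injective
        apply mul_left_cancel₀ hd
        rw [e₂, f₂, e₃]
      · apply (algebraMap F (AlgebraicClosure F)).injective
        apply mul_left_cancel₀ hd
        rw [e₄, f₄, e₃, e₁]
    have h1 : companion a ^ (n - m) = 1 := by
      rw [pow_sub _ hmn, this, mul_inv_cancel]
    have := h.dvd_of_pow_eq_one hN h1
    rcases Nat.eq_zero_or_pos (n - m) with h0 | h0
    · omega
    · have := Nat.le_of_dvd h0 this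
      omega
  calc N = (Finset.range N).card := (Finset.card_range N).symm
    _ ≤ _ := Finset.card_le_card_of_injOn
      (fun n ↦ ((companion a ^ n) 0 0, (companion a ^ n) 1 0))
      (fun n _ ↦ mem_conic.mpr (hform n)) (fun m hm n hn hmn ↦ by
        simp only [Finset.coe_range, Set.mem_Iio] at hm hn
        obtain ⟨h₀, h₁⟩ := Prod.mk.inj hmn
        rcases le_total m n with hle | hle
        · exact hdiv m n hle hn h₀ h₁
        · exact (hdiv n m hle hm h₀.symm h₁.symm).symm)

/-- The discriminant is (z - z⁻¹)², and Frobenius multiplies z - z⁻¹ by e. -/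
lemma discriminant_pow (h : IsTorusGenerator a N z) (hodd : Odd (Fintype.card F)) {e : ℤ} (he : e = 1 ∨ e = -1)
    (heN : (N : ℤ) = Fintype.card F - e) (hN : 3 ≤ N) :
    (a ^ 2 - 4) ^ ((Fintype.card F - 1) / 2) = (e : F) := by
  have hz0 := h.ne_zero (by omega)
  have hd := sub_ne_zero.mpr (h.ne_inv hN)
  have hzz : z * z⁻¹ = 1 := mul_inv_cancel₀ hz0
  obtain ⟨r, hr⟩ := hodd
  apply (algebraMap F (AlgebraicClosure F)).injective
  have hD : algebraMap F (AlgebraicClosure F) (a ^ 2 - 4) = (z - z⁻¹) ^ 2 := by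
    rw [map_sub, map_pow, h.trace, map_ofNat]; linear_combination 4 * hzz
  have hr' : (Fintype.card F - 1) / 2 = r := by omega
  rw [map_pow, hD, hr', ← pow_mul, map_intCast]
  apply mul_right_cancel₀ hd
  rw [← pow_succ, ← hr, sub_eq_add_neg, add_pow_card, neg_pow, Odd.neg_one_pow ⟨r, hr⟩, inv_pow]
  rcases he with rfl | rfl
  · have hc : N + 1 = Fintype.card F := by omega
    have hzq : z ^ Fintype.card F = z := by
      rw [← hc, pow_succ, h.prim.pow_eq_one, one_mul]
    rw [hzq]; simp
  · have hc : N = Fintype.card F + 1 := by omega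
    have hzq : z ^ Fintype.card F = z⁻¹ := eq_inv_of_mul_eq_one_left (by
        rw [← pow_succ, ← hc, h.prim.pow_eq_one])
    rw [hzq]; simp

end IsTorusGenerator

end SpecialLinearTwo

/-! ### Even q. -/

namespace SpecialLinearTwo

section

variable {F : Type*} [Field F]

lemma sq_eq_neg_one_of_tr {A : SL(2, F)} (h : tr A = 0) : A ^ 2 = -1 := by
  apply Subtype.ext
  have := coe_mul_self A
  rw [h, zero_smul, zero_sub, ← pow_two] at this
  exact this

lemma cube_eq_one_of_tr {A : SL(2, F)} (h : tr A = -1) : A ^ 3 = 1 := by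
  apply Subtype.ext
  have hA := coe_mul_self A
  rw [h, neg_one_smul] at hA
  change (A : Matrix (Fin 2) (Fin 2) F) ^ 3 = 1
  rw [pow_succ, pow_two, hA, sub_mul, neg_mul, hA, one_mul]
  abel

lemma tr_mul_shear (A : SL(2, F)) (l : F) : tr (A * shear l) = tr A + l * A 1 0 := by
  simp [tr, mul_apply_two]; ring

lemma three_le_orderOf_of_tr [Finite F] {A : SL(2, F)} (h₁ : tr A ≠ 2) (h₂ : tr A ≠ -2) :
    3 ≤ orderOf A := three_le_orderOf (sq_ne_one_of_tr h₁ h₂)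

lemma four_le_orderOf_of_tr [Finite F] {A : SL(2, F)} (h₁ : tr A ≠ 2) (h₂ : tr A ≠ -2)
    (h₃ : tr A ≠ -1) : 4 ≤ orderOf A :=
  four_le_orderOf (sq_ne_one_of_tr h₁ h₂) (cube_ne_one_of_tr h₁ h₃)

lemma forall_mem_members {G : Type*} {t : GroupTriple G} {P : G → Prop} :
    (∀ g ∈ t.members, P g) ↔ P t.x ∧ P t.y ∧ P t.z := by
  simp [GroupTriple.members]

end

variable {F : Type*} [Field F] [Fintype F]

namespace IsTorusGenerator

variable {a : F} {N : ℕ} {z : AlgebraicClosure F}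

lemma card_sub_one_le (h : IsTorusGenerator a N z) : Fintype.card F - 1 ≤ N := by
  have := h.order; omega

lemma disc_ne_zero (h : IsTorusGenerator a N z) (hN : 3 ≤ N) : a ^ 2 - 4 ≠ 0 := by
  have hz0 := h.ne_zero (by omega)
  have hd := sub_ne_zero.mpr (h.ne_inv hN)
  have hzz : z * z⁻¹ = 1 := mul_inv_cancel₀ hz0
  intro h0
  have : (z - z⁻¹) ^ 2 = 0 := by
    rw [← map_zero (algebraMap F (AlgebraicClosure F)), ← h0, map_sub, map_pow, h.trace,
      map_ofNat]
    linear_combination -4 * hzz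
  exact hd (pow_eq_zero_iff two_ne_zero |>.mp this)

lemma ne_two (h : IsTorusGenerator a N z) (hN : 3 ≤ N) : a ≠ 2 ∧ a ≠ -2 := by
  constructor <;> rintro rfl <;> exact h.disc_ne_zero hN (by norm_num)

lemma pow_ne_one (h : IsTorusGenerator a N z) (hN : 3 ≤ N) {n : ℕ} (hn : 0 < n) (hnN : n < N) :
    companion a ^ n ≠ 1 := fun h1 ↦
  absurd (Nat.le_of_dvd hn (h.dvd_of_pow_eq_one hN h1)) (by omega)

variable [DecidableEq F]

/-- In characteristic two, a torus generator gives a hyperbolic generating triple inside the union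
of the conjugates of its torus. -/
lemma companionTriple_of_char_two (h : IsTorusGenerator a N z) (hq : 5 < Fintype.card F)
    (h9 : Fintype.card F ≠ 9) (h2 : (2 : F) = 0) (hN : 7 ≤ N) (hodd : Odd N) :
    (companionTriple a (a ^ 2 + a) 2 (-1)).Generates ∧
    (companionTriple a (a ^ 2 + a) 2 (-1)).IsHyperbolic ∧
    ∀ g ∈ (companionTriple a (a ^ 2 + a) 2 (-1)).members, g ^ N = 1 := by
  have hz0 := h.ne_zero (by omega)
  have hzz : z * z⁻¹ = 1 := mul_inv_cancel₀ hz0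
  have hneg : ∀ x : F, -x = x := fun x ↦ by linear_combination -x * h2
  have h0 : a ≠ 0 := by rw [← h2]; exact (h.ne_two (by omega)).1
  have h1 : a + 1 ≠ 0 := fun h1 ↦
    h.pow_ne_one (by omega) (n := 3) (by omega) (by omega)
      (cube_eq_one_of_tr (by rw [tr_companion]; exact eq_neg_of_add_eq_zero_left h1))
  -- This l makes W⁻¹u and Wu both have trace a + l = a², the trace of W²; all three members have
  -- eigenvalues z² and z⁻².
  set l := a ^ 2 + a with hl
  have hl0 : l ≠ 0 := by rw [hl, pow_two, ← mul_add_one]; exact mul_ne_zero h0 h1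
  have hla : l + a = a ^ 2 := by rw [hl]; linear_combination a * h2
  have tx : tr (companion a ^ 2) = a ^ 2 := by rw [tr_sq, tr_companion, h2, sub_zero]
  have ty : tr ((companion a)⁻¹ * shear l) = a ^ 2 := by
    rw [tr_mul_shear, tr_inv, tr_companion, (inv_entries _).2.2.1, ← hla]
    simp [hneg, add_comm]
  have tz : tr (companion a * shear l) = a ^ 2 := by
    rw [companion_mul_shear, tr_companion, add_comm, hla]
  have hpow : ∀ A : SL(2, F), tr A = a ^ 2 → A ^ N = 1 := by
    intro A hA
    refine pow_eq_one_of_root A (z := z ^ 2) (pow_ne_zero 2 hz0) ?_ ?_ ?_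
    · have h2' : (2 : AlgebraicClosure F) = 0 := by
        rw [← map_ofNat (algebraMap F (AlgebraicClosure F)), h2, map_zero]
      rw [hA, map_pow, h.trace, ← inv_pow]
      linear_combination 2 * hzz + h2'
    · intro he
      have : z ^ 4 = 1 := by
        rw [show 4 = 2 + 2 from rfl, pow_add]; nth_rw 2 [he]
        exact mul_inv_cancel₀ (pow_ne_zero 2 hz0)
      have := Nat.le_of_dvd (by norm_num) (h.prim.dvd_of_pow_eq_one 4 this)
      omega
    · rw [← pow_mul, mul_comm, pow_mul, h.prim.pow_eq_one, one_pow]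
  have hne2 : a ^ 2 ≠ 2 := by rw [h2]; exact pow_ne_zero 2 h0
  have hne2' : a ^ 2 ≠ -2 := by rw [h2, neg_zero]; exact pow_ne_zero 2 h0
  refine ⟨companionTriple_generates ?_ ?_, ?_, ?_⟩
  -- N is odd, so W is the (N + 1)/2-th power of W².
  · obtain ⟨r, hr⟩ := hodd
    refine ⟨r + 1, ?_⟩
    have : companion a ^ (2 * (r + 1)) = companion a := by
      rw [show 2 * (r + 1) = N + 1 by omega, pow_succ, h.pow_eq_one (by omega), one_mul]
    change (companion a ^ (2 : ℤ)) ^ ((r : ℤ) + 1) = companion a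
    rw [← zpow_mul]
    exact_mod_cast this
  · intro H hW hs
    exact eq_top_of_containsTorus hq h9 (h.containsTorus (by omega) hW)
      (h.card_sub_one_le.trans (h.le_card_conic (by omega))) hl0
      (fun _ ↦ by rw [hla]; exact pow_ne_zero 2 h0) hW hs
  · refine isHyperbolic_of_orders ?_ ?_ ?_ (Or.inl ?_)
    · simp only [companionTriple]
      rw [zpow_ofNat]
      exact three_le_orderOf_of_tr (by rwa [tx]) (by rwa [tx])
    · simp only [companionTriple, zpow_neg_one]
      exact three_le_orderOf_of_tr (by rwa [ty]) (by rwa [ty])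
    · simp only [companionTriple, orderOf_inv]
      norm_num
      exact three_le_orderOf_of_tr (by rwa [tz]) (by rwa [tz])
    · simp only [companionTriple]
      have h4 := h.pow_ne_one (by omega) (n := 4) (by omega) (by omega)
      have h6 := h.pow_ne_one (by omega) (n := 6) (by omega) (by omega)
      norm_cast
      exact four_le_orderOf (by rwa [← pow_mul]) (by rwa [← pow_mul])
  · rw [forall_mem_members]
    refine ⟨hpow _ ?_, hpow _ ?_, hpow _ ?_⟩
    · simp only [companionTriple]; norm_cast
    · simp only [companionTriple, zpow_neg_one]; exact ty
    · simp only [companionTriple, tr_inv]; norm_num; exact tz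

end IsTorusGenerator

theorem admitsStronglyReal_of_char_two (hq : 5 < Fintype.card F) (h2 : (2 : F) = 0) :
    AdmitsStronglyRealBeauvilleStructure SL(2, F) := by
  classical
  have := CharTwo.of_one_ne_zero_of_two_eq_zero (R := F) one_ne_zero h2
  obtain ⟨n, -, hn⟩ := FiniteField.card F 2
  have h8 : 8 ≤ Fintype.card F := by
    rw [hn] at hq ⊢
    have : 3 ≤ (n : ℕ) := by
      by_contra! hlt
      interval_cases (n : ℕ) <;> simp_all
    calc 8 = 2 ^ 3 := by norm_num
      _ ≤ _ := Nat.pow_le_pow_right (by norm_num) this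
  have heven : Even (Fintype.card F) := by
    rw [hn, Nat.even_pow]; exact ⟨even_two, n.ne_zero⟩
  have h9 : Fintype.card F ≠ 9 := by rintro h; rw [h] at heven; revert heven; decide
  obtain ⟨a, z, h⟩ := exists_isTorusGenerator (F := F) (N := Fintype.card F - 1)
    (Or.inl (by omega))
  obtain ⟨b, w, h'⟩ := exists_isTorusGenerator (F := F) (N := Fintype.card F + 1) (Or.inr rfl)
  have hodd₁ : Odd (Fintype.card F - 1) := Nat.Even.sub_odd (by omega) heven odd_one
  have hodd₂ : Odd (Fintype.card F + 1) := heven.add_one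
  obtain ⟨g₁, y₁, e₁⟩ := h.companionTriple_of_char_two hq h9 h2 (by omega) hodd₁
  obtain ⟨g₂, y₂, e₂⟩ := h'.companionTriple_of_char_two hq h9 h2 (by omega) hodd₂
  refine admitsStronglyReal_of_companionTriples ?_ g₁ g₂ y₁ y₂ e₁ e₂
  have : Fintype.card F + 1 = (Fintype.card F - 1) + 2 := by omega
  rw [this, Nat.coprime_self_add_right]
  exact Nat.coprime_two_right.mpr hodd₁

end SpecialLinearTwo

/-! ### Odd q ≥ 23. -/

namespace SpecialLinearTwo

section Unipotent

variable {F : Type*} [Field F]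

lemma tr_companion_mul_companion (a b : F) : tr (companion a * companion b) = a * b - 2 := by
  simp [tr, mul_apply_two]; ring

/-- The triple `(W⁻¹, W u, u⁻¹)` with `W u = companion 2` unipotent. -/
lemma unipotentTriple_isHyperbolic [Finite F] (h2 : (2 : F) ≠ 0) {c : F} (hc : c ≠ 2)
    (hc' : c ≠ -2) : (companionTriple c (2 - c) (-1) 1).IsHyperbolic := by
  have := Fintype.ofFinite F
  obtain ⟨p, hp⟩ := CharP.exists F
  obtain ⟨n, hpr, hn⟩ := FiniteField.card F p
  have hpf : Fact p.Prime := ⟨hpr⟩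
  have hp2 : p ≠ 2 := by
    rintro rfl
    exact h2 (by exact_mod_cast CharP.cast_eq_zero F 2)
  have hp3 : 3 ≤ p := by have := hpr.two_le; omega
  have hy : orderOf (companion (2 : F)) = p :=
    orderOf_unipotent (by simp) (companion_ne_one 2) p
  have hz : orderOf (shear (2 - c)) = p :=
    orderOf_unipotent (by simp) (shear_ne_one (sub_ne_zero.mpr hc.symm)) p
  have ey : (companionTriple c (2 - c) (-1) 1).y = companion 2 := by
    simp only [companionTriple, zpow_one, companion_mul_shear]; congr 1; ring
  have ez : (companionTriple c (2 - c) (-1) 1).z = (shear (2 - c))⁻¹ := by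
    simp [companionTriple]
  have ex : (companionTriple c (2 - c) (-1) 1).x = (companion c)⁻¹ := by
    simp [companionTriple]
  refine isHyperbolic_of_orders ?_ ?_ ?_ ?_
  · rw [ex, orderOf_inv]; exact three_le_orderOf_of_tr (by simpa) (by simpa)
  · rw [ey, hy]; exact hp3
  · rw [ez, orderOf_inv, hz]; exact hp3
  -- For p = 3 the unipotents have order only 3, so W must supply order at least 4; it does, since
  -- -1 = 2 is not its trace.
  rcases eq_or_ne p 3 with rfl | hne
  · left
    have h3 : (3 : F) = 0 := by exact_mod_cast CharP.cast_eq_zero F 3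
    have hc1 : c ≠ -1 := by
      intro h; apply hc; rw [h]; linear_combination -h3
    rw [ex, orderOf_inv]; exact four_le_orderOf_of_tr (by simpa) (by simpa) (by simpa)
  · right; left
    rw [ey, hy]; omega

lemma unipotentTriple_pow (p : ℕ) [CharP F p] {c : F} {m : ℕ} (hm : companion c ^ m = 1) :
    ∀ g ∈ (companionTriple c (2 - c) (-1) 1).members, g ^ (m * p) = 1 := by
  have ey : (companionTriple c (2 - c) (-1) 1).y = companion 2 := by
    simp only [companionTriple, zpow_one, companion_mul_shear]; congr 1; ring
  rw [forall_mem_members, ey]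
  refine ⟨?_, ?_, ?_⟩
  · simp only [companionTriple, zpow_neg_one, inv_pow]
    rw [pow_mul, hm, one_pow, inv_one]
  · rw [mul_comm, pow_mul, unipotent_pow_char _ (by simp) p, one_pow]
  · simp only [companionTriple, neg_add_cancel, zpow_zero, one_mul, inv_pow]
    rw [mul_comm, pow_mul, unipotent_pow_char _ (by simp) p, one_pow, inv_one]

lemma unipotentTriple_generates {c : F}
    (hgen : ∀ H : Subgroup SL(2, F), companion c ∈ H → shear (2 - c) ∈ H → H = ⊤) :
    (companionTriple c (2 - c) (-1) 1).Generates := by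
  refine companionTriple_generates ?_ hgen
  rw [zpow_neg_one, Subgroup.zpowers_inv]
  exact Subgroup.mem_zpowers _

/-- Passing to trace -a replaces W by -W up to `flipSigns`. If W has order 2m with m odd, this
yields an element of exponent m. -/
lemma flipSigns_companion (a : F) : companion (-a) = -flipSigns (companion a) := by
  obtain ⟨p, q, r, s⟩ := flipSigns_entries (companion a)
  apply ext_entries <;> rw [Matrix.SpecialLinearGroup.coe_neg, Matrix.neg_apply] <;>
    simp only [p, q, r, s] <;> simp

lemma companion_neg_pow (a : F) (n : ℕ) :
    companion (-a) ^ n = (-1) ^ n * flipSigns (companion a ^ n) := by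
  rw [flipSigns_companion, neg_pow]
  congr 1
  exact (map_pow reflect (companion a) n).symm

end Unipotent

variable {F : Type*} [Field F] [Fintype F]

lemma two_ne_zero_of_odd_card (hodd : Odd (Fintype.card F)) : (2 : F) ≠ 0 := by
  intro h2
  have := CharTwo.of_one_ne_zero_of_two_eq_zero (R := F) one_ne_zero h2
  have := FiniteField.even_card_of_char_two (ringChar.eq F 2)
  rw [Nat.odd_iff] at hodd
  omega

namespace IsTorusGenerator

variable {a : F} {N : ℕ} {z : AlgebraicClosure F}

/-- The sign allowed in `ContainsTorus` matters here: when N = 2m with m odd, `companion (-a)` has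
at most m powers, not all the norm-one elements. -/
lemma containsTorus_neg (h : IsTorusGenerator a N z) (hN : 3 ≤ N) {H : Subgroup SL(2, F)}
    (hW : companion (-a) ∈ H) : ContainsTorus (-a) H := by
  intro x y hxy
  obtain ⟨n, h₁, h₂, h₃, h₄⟩ := h.exists_pow hN (x := x) (y := -y) (by
    unfold normForm at *; linear_combination hxy)
  obtain ⟨p, q, r, s⟩ := flipSigns_entries (companion a ^ n)
  refine ⟨companion (-a) ^ n, pow_mem hW n, (-1) ^ n, by rw [← pow_mul, mul_comm, pow_mul]; simp, ?_⟩
  have e : ∀ i j, (companion (-a) ^ n) i j = (-1) ^ n * flipSigns (companion a ^ n) i j := by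
    intro i j
    rw [companion_neg_pow]
    rcases Nat.even_or_odd n with hn | hn
    · rw [hn.neg_one_pow, hn.neg_one_pow, one_mul, one_mul]
    · rw [hn.neg_one_pow, hn.neg_one_pow, neg_one_mul, neg_one_mul,
        Matrix.SpecialLinearGroup.coe_neg, Matrix.neg_apply]
  rw [e, e, e, e, p, q, r, s, h₁, h₂, h₃, h₄]
  refine ⟨by ring, by ring, by ring, by ring⟩

lemma le_card_conic_neg [DecidableEq F] (h : IsTorusGenerator a N z) (hN : 3 ≤ N) :
    N ≤ (conic (-a)).card := by
  refine (h.le_card_conic hN).trans ?_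
  refine Finset.card_le_card_of_injOn (fun w ↦ (w.1, -w.2)) ?_ ?_
  · intro w hw
    have hw := mem_conic.mp hw
    refine mem_conic.mpr ?_
    simp only [normForm] at *
    linear_combination hw
  · intro w _ w' _ hww
    obtain ⟨h₁, h₂⟩ := Prod.mk.inj hww
    exact Prod.ext h₁ (neg_injective h₂)

lemma companion_neg_pow_eq_one (h : IsTorusGenerator a N z) {m : ℕ} (hN : N = 2 * m)
    (hm : Odd m) (hN3 : 3 ≤ N) : companion (-a) ^ m = 1 := by
  have hzm : z ^ m = -1 := by
    have h1 := h.prim.pow_eq_one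
    rw [hN, mul_comm, pow_mul, pow_two] at h1
    refine (mul_self_eq_one_iff.mp h1).resolve_left fun h0 ↦ ?_
    have := Nat.le_of_dvd hm.pos (h.prim.dvd_of_pow_eq_one m h0)
    omega
  have hz0 := h.ne_zero (by omega)
  refine pow_eq_one_of_root (companion (-a)) (z := -z) (neg_ne_zero.mpr hz0) ?_ ?_ ?_
  · rw [tr_companion, map_neg, h.trace, inv_neg]; ring
  · rw [inv_neg]; exact fun e ↦ h.ne_inv hN3 (neg_injective e)
  · rw [hm.neg_pow, hzm, neg_neg]

/-- The triple of odd order elements. -/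
lemma unipotentTriple_neg [DecidableEq F] (h : IsTorusGenerator a N z) (p : ℕ) [CharP F p]
    (hq : 5 < Fintype.card F)
    (h9 : Fintype.card F ≠ 9) (hodd : Odd (Fintype.card F)) {m : ℕ} (hN : N = 2 * m) (hm : Odd m)
    (hN3 : 3 ≤ N) :
    (companionTriple (-a) (2 - -a) (-1) 1).Generates ∧
    (companionTriple (-a) (2 - -a) (-1) 1).IsHyperbolic ∧
    ∀ g ∈ (companionTriple (-a) (2 - -a) (-1) 1).members, g ^ (m * p) = 1 := by
  have h2 := two_ne_zero_of_odd_card hodd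
  obtain ⟨a2, a2'⟩ := h.ne_two hN3
  have c2 : -a ≠ 2 := fun e ↦ a2' (by rw [← e, neg_neg])
  refine ⟨unipotentTriple_generates fun H hW hs ↦ ?_,
    unipotentTriple_isHyperbolic h2 c2 (fun e ↦ a2 (neg_injective e)),
    unipotentTriple_pow p (h.companion_neg_pow_eq_one hN hm hN3)⟩
  exact eq_top_of_containsTorus hq h9 (h.containsTorus_neg hN3 hW)
    (h.card_sub_one_le.trans (h.le_card_conic_neg hN3)) (sub_ne_zero.mpr c2.symm)
    (fun h ↦ absurd h h2) hW hs

end IsTorusGenerator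

lemma pow_half_eq {x : F} (hodd : Odd (Fintype.card F)) (hx : x ≠ 0) :
    x ^ ((Fintype.card F - 1) / 2) = 1 ∨ x ^ ((Fintype.card F - 1) / 2) = -1 := by
  have : (Fintype.card F - 1) / 2 = Fintype.card F / 2 := by
    obtain ⟨r, hr⟩ := hodd; omega
  rw [this]
  refine FiniteField.pow_dichotomy (fun h ↦ ?_) hx
  have := FiniteField.even_card_of_char_two h
  rw [Nat.odd_iff] at hodd
  omega

lemma sq_pow_half_eq {x : F} (hodd : Odd (Fintype.card F)) (hx : x ≠ 0) :
    (x ^ 2) ^ ((Fintype.card F - 1) / 2) = 1 := by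
  rw [← pow_mul]
  obtain ⟨r, hr⟩ := hodd
  rw [show 2 * ((Fintype.card F - 1) / 2) = Fintype.card F - 1 by omega]
  exact FiniteField.pow_card_sub_one_eq_one x hx

namespace IsTorusGenerator

variable {a : F} {N : ℕ} {z : AlgebraicClosure F}

/-- The lower left entry of Wⁿ is U_n = (zⁿ - z⁻ⁿ)/(z - z⁻¹), which vanishes only if z²ⁿ = 1. -/
lemma entry_ne_zero (h : IsTorusGenerator a N z) (hN : 3 ≤ N) {n : ℕ} (hn : 0 < n)
    (hnN : 2 * n < N) : (companion a ^ n) 1 0 ≠ 0 := by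
  intro h0
  obtain ⟨-, -, e, -⟩ := h.companion_pow_entries hN n
  have hz0 := h.ne_zero (by omega)
  rw [h0, map_zero, mul_zero, inv_pow] at e
  have e' : z ^ n = (z ^ n)⁻¹ := sub_eq_zero.mp e.symm
  have : z ^ (2 * n) = 1 := by
    rw [two_mul, pow_add]; nth_rw 2 [e']; exact mul_inv_cancel₀ (pow_ne_zero _ hz0)
  have := Nat.le_of_dvd (by omega) (h.prim.dvd_of_pow_eq_one _ this)
  omega

lemma trace_pow (h : IsTorusGenerator a N z) (hN : 3 ≤ N) (n : ℕ) :
    algebraMap F (AlgebraicClosure F) (tr (companion a ^ n)) = z ^ n + z⁻¹ ^ n := by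
  obtain ⟨e₁, -, -, e₂⟩ := h.companion_pow_entries hN n
  have hz0 := h.ne_zero (by omega)
  have hd := sub_ne_zero.mpr (h.ne_inv hN)
  apply mul_left_cancel₀ hd
  rw [tr, map_add, mul_add, e₁, e₂, h.trace]
  ring

lemma trace_ne_zero (h : IsTorusGenerator a N z) (hN : 3 ≤ N) {n : ℕ} (hn : 0 < n)
    (hnN : 4 * n < N) : tr (companion a ^ n) ≠ 0 := by
  intro h0
  have e := h.trace_pow hN n
  have hz0 := h.ne_zero (by omega)
  have hzn := pow_ne_zero n hz0
  rw [h0, map_zero, inv_pow] at e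
  have e' : (z ^ n)⁻¹ = -z ^ n := (neg_eq_of_add_eq_zero_right e.symm).symm
  have e₂ : z ^ n * z ^ n = -1 := by
    have := mul_inv_cancel₀ hzn
    rw [e'] at this; linear_combination -this
  have : z ^ (4 * n) = 1 := by
    rw [show 4 * n = n + n + (n + n) by ring, pow_add, pow_add, e₂]; norm_num
  have := Nat.le_of_dvd (by omega) (h.prim.dvd_of_pow_eq_one _ this)
  omega

/-- The discriminant of `W ^ n u` for `u = shear (Δ U_l / s_l)`. -/
lemma disc_pow_mul_shear (h : IsTorusGenerator a N z) (hN : 3 ≤ N) (n l : ℕ)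
    (hl : tr (companion a ^ l) ≠ 0) :
    tr (companion a ^ n *
        shear ((a ^ 2 - 4) * (companion a ^ l) 1 0 / tr (companion a ^ l))) ^ 2 - 4 =
      (a ^ 2 - 4) * (2 / tr (companion a ^ l)) ^ 2 *
        ((companion a ^ n) 1 0 * (companion a ^ (n + 2 * l)) 1 0) := by
  rw [tr_mul_shear]
  have hz0 := h.ne_zero (by omega)
  have hzz : z * z⁻¹ = 1 := mul_inv_cancel₀ hz0
  obtain ⟨-, -, en, -⟩ := h.companion_pow_entries hN n
  obtain ⟨-, -, el, -⟩ := h.companion_pow_entries hN l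
  obtain ⟨-, -, enl, -⟩ := h.companion_pow_entries hN (n + 2 * l)
  have tn := h.trace_pow hN n
  have tl := h.trace_pow hN l
  have hX : z ^ n * z⁻¹ ^ n = 1 := by rw [← mul_pow, hzz, one_pow]
  have hY : z ^ l * z⁻¹ ^ l = 1 := by rw [← mul_pow, hzz, one_pow]
  have hD : algebraMap F (AlgebraicClosure F) (a ^ 2 - 4) = (z - z⁻¹) ^ 2 := by
    rw [map_sub, map_pow, h.trace, map_ofNat]; linear_combination 4 * hzz
  have hZ : ∀ w : AlgebraicClosure F, w ^ (n + 2 * l) = w ^ n * (w ^ l) ^ 2 := fun w ↦ by ring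
  rw [hZ, hZ] at enl
  set Un := (companion a ^ n) 1 0
  set Ul := (companion a ^ l) 1 0
  set Unl := (companion a ^ (n + 2 * l)) 1 0
  set sn := tr (companion a ^ n)
  set sl := tr (companion a ^ l)
  -- With s_n = zⁿ + z⁻ⁿ and Δ = a² - 4, the shear is chosen so that Wⁿu has trace 2 s_(n+l)/s_l;
  -- and s_(n+l)² - s_l² = Δ U_n U_(n+2l).
  have key : (sn * sl + (a ^ 2 - 4) * Ul * Un) ^ 2 - 4 * sl ^ 2 =
      4 * (a ^ 2 - 4) * (Un * Unl) := by
    apply (algebraMap F (AlgebraicClosure F)).injective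
    have e₁ : algebraMap F (AlgebraicClosure F) ((a ^ 2 - 4) * Ul * Un) =
        (z ^ l - z⁻¹ ^ l) * (z ^ n - z⁻¹ ^ n) := by
      rw [map_mul, map_mul, hD, ← en, ← el]; ring
    have e₂ : algebraMap F (AlgebraicClosure F) (4 * (a ^ 2 - 4) * (Un * Unl)) =
        4 * ((z ^ n - z⁻¹ ^ n) * (z ^ n * (z ^ l) ^ 2 - z⁻¹ ^ n * (z⁻¹ ^ l) ^ 2)) := by
      rw [map_mul, map_mul, map_mul, hD, ← en, ← enl, map_ofNat]; ring
    rw [e₂, map_sub, map_pow, map_add, e₁, map_mul, map_mul, map_pow, tn, tl, map_ofNat]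
    generalize z ^ n = X at *
    generalize z⁻¹ ^ n = X' at *
    generalize z ^ l = Y at *
    generalize z⁻¹ ^ l = Y' at *
    linear_combination (4 * Y ^ 2 + 4 * Y' ^ 2 + 8 * Y * Y') * hX
  field_simp
  linear_combination key

/-- Two equal patterns of quadratic characters yield a triple inside the conjugates of the
torus. -/
lemma exists_companionTriple (h : IsTorusGenerator a N z) (hodd : Odd (Fintype.card F)) {e : ℤ}
    (he : e = 1 ∨ e = -1) (heN : (N : ℤ) = Fintype.card F - e) (h4 : 4 ∣ N) (hN : 24 ≤ N) :
    ∃ (l : F) (i : ℤ), l ≠ 0 ∧ (companionTriple a l 1 i).IsHyperbolic ∧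
      ∀ g ∈ (companionTriple a l 1 i).members, g ^ N = 1 := by
  classical
  have h2 := two_ne_zero_of_odd_card hodd
  have hN3 : 3 ≤ N := by omega
  obtain ⟨M, hM⟩ := h4
  set k := (Fintype.card F - 1) / 2 with hk
  set U : ℕ → F := fun n ↦ (companion a ^ n) 1 0 with hU
  have hU0 : ∀ n, 0 < n → 2 * n < N → U n ≠ 0 := fun n hn hnN ↦ h.entry_ne_zero hN3 hn hnN
  have hmaps : ∀ r ∈ Finset.Icc 1 (M - 1), (U (2 * r) ^ k, U (2 * r + 1) ^ k) ∈
      (({1, -1} : Finset F) ×ˢ ({1, -1} : Finset F)) := by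
    intro r hr
    rw [Finset.mem_Icc] at hr
    simp only [Finset.mem_product, Finset.mem_insert, Finset.mem_singleton]
    exact ⟨pow_half_eq hodd (hU0 _ (by omega) (by omega)),
      pow_half_eq hodd (hU0 _ (by omega) (by omega))⟩
  -- The pigeonhole: N = 4M ≥ 24 gives at least 5 indices r for the 4 possible pairs of quadratic
  -- characters of U_(2r), U_(2r+1).
  have hcard : (({1, -1} : Finset F) ×ˢ ({1, -1} : Finset F)).card <
      (Finset.Icc 1 (M - 1)).card := by
    rw [Finset.card_product, Nat.card_Icc]
    have : ({1, -1} : Finset F).card ≤ 2 := Finset.card_le_two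
    calc _ ≤ 2 * 2 := Nat.mul_le_mul this this
      _ < _ := by omega
  obtain ⟨r, hr, r', hr', hne, heq⟩ := Finset.exists_ne_map_eq_of_card_lt_of_maps_to hcard hmaps
  wlog hlt : r < r' generalizing r r'
  · exact this r' hr' r hr hne.symm heq.symm (by omega)
  rw [Finset.mem_Icc] at hr hr'
  set l := r' - r with hl
  have hsl : tr (companion a ^ l) ≠ 0 := h.trace_ne_zero hN3 (by omega) (by omega)
  have hUl : (companion a ^ l) 1 0 ≠ 0 := h.entry_ne_zero hN3 (by omega) (by omega)
  have hD := h.disc_ne_zero hN3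
  set L := (a ^ 2 - 4) * (companion a ^ l) 1 0 / tr (companion a ^ l) with hL
  obtain ⟨p₁, p₂⟩ := Prod.mk.inj heq
  -- When U_n and U_(n+2l) have equal character, the discriminant of Wⁿu is that of W times a
  -- square. Taking n = 2r and n = 2r + 1 handles both remaining members.
  have prod : ∀ n, 0 < n → 2 * n < N → U n ^ k = U (n + 2 * l) ^ k →
      (tr (companion a ^ n * shear L) ^ 2 - 4) ^ k = (e : F) := by
    intro n hn hnN hp
    have hn0 := hU0 n hn hnN
    rw [hL, h.disc_pow_mul_shear hN3 n l hsl, mul_pow, mul_pow, mul_pow,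
      h.discriminant_pow hodd he heN hN3, sq_pow_half_eq hodd (div_ne_zero h2 hsl)]
    change e * 1 * (U n ^ k * U (n + 2 * l) ^ k) = e
    rw [← hp, ← pow_two, ← pow_mul, mul_comm k, pow_mul, sq_pow_half_eq hodd hn0]
    ring
  have q₁ := prod (2 * r) (by omega) (by omega) (by
    rw [p₁]; congr 2; omega)
  have q₂ := prod (2 * r + 1) (by omega) (by omega) (by
    rw [p₂]; congr 2; omega)
  have hk0 : k ≠ 0 := by
    have := h.order; omega
  have ne2 : ∀ A : SL(2, F), (tr A ^ 2 - 4) ^ k = (e : F) → tr A ≠ 2 ∧ tr A ≠ -2 := by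
    intro A hA
    have he0 : (e : F) ≠ 0 := by rcases he with rfl | rfl <;> simp
    constructor <;> intro ht <;> rw [ht] at hA <;> apply he0 <;> rw [← hA] <;> norm_num <;>
      exact hk0
  have pow : ∀ A : SL(2, F), (tr A ^ 2 - 4) ^ k = (e : F) → A ^ N = 1 := by
    intro A hA
    have := pow_of_discriminant (Nat.card_eq_fintype_card (α := F)) hodd A he hA
    rw [← heN] at this
    exact_mod_cast this
  refine ⟨L, (2 * r : ℕ), div_ne_zero (mul_ne_zero hD hUl) hsl, ?_, ?_⟩
  · have ey : (companionTriple a L 1 (2 * r : ℕ)).y = companion a ^ (2 * r) * shear L := by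
      simp only [companionTriple, zpow_natCast]
    have ez : (companionTriple a L 1 (2 * r : ℕ)).z = (companion a ^ (2 * r + 1) * shear L)⁻¹ := by
      simp only [companionTriple, add_comm (1 : ℤ)]; norm_cast
    have ex : (companionTriple a L 1 (2 * r : ℕ)).x = companion a := by
      simp only [companionTriple, zpow_one]
    have hx : 4 ≤ orderOf (companion a) :=
      four_le_orderOf (h.pow_ne_one hN3 (by omega) (by omega))
        (h.pow_ne_one hN3 (by omega) (by omega))
    refine isHyperbolic_of_orders (by rw [ex]; omega) ?_ ?_ (Or.inl (by rwa [ex]))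
    · rw [ey]; exact three_le_orderOf_of_tr (ne2 _ q₁).1 (ne2 _ q₁).2
    · rw [ez, orderOf_inv]; exact three_le_orderOf_of_tr (ne2 _ q₂).1 (ne2 _ q₂).2
  · rw [forall_mem_members]
    refine ⟨?_, ?_, ?_⟩
    · simp only [companionTriple, zpow_one]; exact h.pow_eq_one hN3
    · simp only [companionTriple, zpow_natCast]; exact pow _ q₁
    · simp only [companionTriple, add_comm (1 : ℤ)]
      rw [inv_pow, inv_eq_one]
      norm_cast
      exact pow _ q₂

end IsTorusGenerator

/-- A common divisor of N and m divides 2m - N = 2e and is odd; and p divides q, so not q ± 1. -/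
lemma coprime_torus_orders {q N m p : ℕ} {e : ℤ} (he : e = 1 ∨ e = -1) (hN : (N : ℤ) = q - e)
    (hm : 2 * (m : ℤ) = q + e) (hodd : Odd m) (hp : p.Prime) (hpq : p ∣ q) :
    N.Coprime (m * p) := by
  refine Nat.Coprime.mul_right ?_ ?_
  · have h₁ : N.gcd m ∣ 2 := by
      have a : ((N.gcd m : ℕ) : ℤ) ∣ N := by exact_mod_cast Nat.gcd_dvd_left N m
      have b : ((N.gcd m : ℕ) : ℤ) ∣ m := by exact_mod_cast Nat.gcd_dvd_right N m
      have c : ((N.gcd m : ℕ) : ℤ) ∣ 2 * e := by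
        have : 2 * e = 2 * (m : ℤ) - N := by rw [hm, hN]; ring
        rw [this]; exact dvd_sub (b.mul_left 2) a
      have d : ((N.gcd m : ℕ) : ℤ) ∣ 2 := by
        rcases he with rfl | rfl
        · simpa using c
        · simpa using c
      exact_mod_cast d
    have h₂ : Odd (N.gcd m) := Odd.of_dvd_nat hodd (Nat.gcd_dvd_right N m)
    rcases (Nat.dvd_prime Nat.prime_two).mp h₁ with h | h
    · exact h
    · rw [h] at h₂; exact absurd h₂ (by decide)
  · rw [Nat.coprime_comm, hp.coprime_iff_not_dvd]
    intro hd
    have a : (p : ℤ) ∣ N := by exact_mod_cast hd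
    have b : (p : ℤ) ∣ q := by exact_mod_cast hpq
    have c : (p : ℤ) ∣ e := by
      have : e = q - N := by rw [hN]; ring
      rw [this]; exact dvd_sub b a
    have : (p : ℤ) ∣ 1 := by
      rcases he with rfl | rfl
      · exact c
      · simpa using c
    have : p ∣ 1 := by exact_mod_cast this
    exact hp.one_lt.ne' (Nat.dvd_one.mp this)

theorem admitsStronglyReal_of_odd_of_large (hodd : Odd (Fintype.card F))
    (hq : 23 ≤ Fintype.card F) : AdmitsStronglyRealBeauvilleStructure SL(2, F) := by
  classical
  obtain ⟨p, hp⟩ := CharP.exists F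
  obtain ⟨n, hpr, hn⟩ := FiniteField.card F p
  set q := Fintype.card F with hqd
  -- Take e ≡ q modulo 4: then 4 divides q - e and (q + e)/2 is odd.
  obtain ⟨e, he, N, m, hN, hm, h4, hmo, hN', hm', h24⟩ : ∃ e : ℤ, (e = 1 ∨ e = -1) ∧ ∃ N m : ℕ,
      (N : ℤ) = q - e ∧ 2 * (m : ℤ) = q + e ∧ 4 ∣ N ∧ Odd m ∧ (N + 1 = q ∨ N = q + 1) ∧
      (2 * m + 1 = q ∨ 2 * m = q + 1) ∧ 24 ≤ N := by
    obtain ⟨r, hr⟩ := hodd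
    rcases Nat.even_or_odd' r with ⟨s, hs | hs⟩
    · exact ⟨1, Or.inl rfl, 4 * s, 2 * s + 1, by omega, by omega, ⟨s, rfl⟩, ⟨s, rfl⟩, by omega,
        by omega, by omega⟩
    · exact ⟨-1, Or.inr rfl, 4 * s + 4, 2 * s + 1, by omega, by omega, ⟨s + 1, by ring⟩, ⟨s, rfl⟩,
        by omega, by omega, by omega⟩
  obtain ⟨a, z, h⟩ := exists_isTorusGenerator hN'
  obtain ⟨b, w, h'⟩ := exists_isTorusGenerator hm'
  obtain ⟨l, i, hl, y₁, e₁⟩ := h.exists_companionTriple hodd he hN h4 h24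
  obtain ⟨g₂, y₂, e₂⟩ := h'.unipotentTriple_neg p (by omega) (by omega) hodd rfl hmo (by omega)
  refine admitsStronglyReal_of_companionTriples
    (coprime_torus_orders he hN hm hmo hpr (hn ▸ dvd_pow_self p n.ne_zero))
    (companionTriple_generates ?_ fun H hW hs ↦ ?_) g₂ y₁ y₂ e₁ e₂
  · rw [zpow_one]; exact Subgroup.mem_zpowers _
  · exact eq_top_of_containsTorus (by omega) (by omega) (h.containsTorus (by omega) hW)
      (h.card_sub_one_le.trans (h.le_card_conic (by omega))) hl
      (fun h2 ↦ absurd h2 (two_ne_zero_of_odd_card hodd)) hW hs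

end SpecialLinearTwo

/-! ### The primes from 7 to 19. -/

namespace SpecialLinearTwo

variable {F : Type*} [Field F] [Fintype F]

/-- The first triple has traces a, b, ab - 2, and the last three hypotheses give it exponent N. The
second consists of an element of order 3 (trace -1) and two unipotents. Over a prime field one
nontrivial shear already gives all of them. -/
lemma admitsStronglyReal_of_prime {p : ℕ} (hp : p.Prime) (hp3 : 3 < p)
    (hcard : Fintype.card F = p)
    (a b e : ℤ) (he : e = 1 ∨ e = -1) (N : ℕ) (hN : (N : ℤ) = p - e) (hcop : N.Coprime (3 * p))
    (hab : ¬ (p : ℤ) ∣ b - a) (ha : ¬ (p : ℤ) ∣ a + 1)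
    (h₁ : (p : ℤ) ∣ (a ^ 2 - 4) ^ ((p - 1) / 2) - e)
    (h₂ : (p : ℤ) ∣ (b ^ 2 - 4) ^ ((p - 1) / 2) - e)
    (h₃ : (p : ℤ) ∣ ((a * b - 2) ^ 2 - 4) ^ ((p - 1) / 2) - e) :
    AdmitsStronglyRealBeauvilleStructure SL(2, F) := by
  have : Fact p.Prime := ⟨hp⟩
  have : CharP F p := charP_of_card_eq_prime hcard
  have hcast : ∀ x : ℤ, (x : F) = 0 ↔ (p : ℤ) ∣ x := fun x ↦ CharP.intCast_eq_zero_iff F p x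
  have hodd : Odd (Fintype.card F) := hcard ▸ hp.odd_of_ne_two (by omega)
  have h2 := two_ne_zero_of_odd_card hodd
  have hpr : (Nat.card F).Prime := by rwa [Nat.card_eq_fintype_card, hcard]
  have hl : (b : F) - a ≠ 0 := by rw [← Int.cast_sub, Ne, hcast]; exact hab
  have disc : ∀ t : ℤ, (p : ℤ) ∣ (t ^ 2 - 4) ^ ((p - 1) / 2) - e →
      ((t : F) ^ 2 - 4) ^ ((p - 1) / 2) = (e : F) := by
    intro t ht
    rw [← hcast] at ht
    push_cast at ht
    exact sub_eq_zero.mp ht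
  have hk0 : (p - 1) / 2 ≠ 0 := by omega
  have ne2 : ∀ t : F, (t ^ 2 - 4) ^ ((p - 1) / 2) = (e : F) → t ≠ 2 ∧ t ≠ -2 := by
    intro t hA
    have he0 : (e : F) ≠ 0 := by rcases he with rfl | rfl <;> simp
    constructor <;> intro ht <;> rw [ht] at hA <;> apply he0 <;> rw [← hA] <;> norm_num <;>
      omega
  have pow : ∀ A : SL(2, F), (tr A ^ 2 - 4) ^ ((p - 1) / 2) = (e : F) → A ^ N = 1 := by
    intro A hA
    have := pow_of_discriminant (by rw [Nat.card_eq_fintype_card, hcard]) (hcard ▸ hodd) A he hA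
    rw [← hN] at this
    exact_mod_cast this
  have tx : tr (companion (a : F)) = (a : ℤ) := by simp
  have ey : (companionTriple (a : F) (b - a) 1 1).y = companion (b : F) := by
    simp only [companionTriple, zpow_one, companion_mul_shear]; congr 1; ring
  have ex : (companionTriple (a : F) (b - a) 1 1).x = companion (a : F) := by
    simp only [companionTriple, zpow_one]
  have ez : (companionTriple (a : F) (b - a) 1 1).z = (companion (a : F) * companion (b : F))⁻¹ := by
    simp only [companionTriple, zpow_add, zpow_one, mul_assoc, companion_mul_shear]
    congr 3; ring
  have d₁ := disc a h₁
  have d₂ := disc b h₂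
  have d₃ := disc (a * b - 2) h₃
  push_cast at d₃
  have hc2 : (-1 : F) ≠ 2 := by
    intro h
    have : ((3 : ℤ) : F) = 0 := by push_cast; linear_combination -h
    rw [hcast] at this
    exact absurd (Int.le_of_dvd (by norm_num) this) (by omega)
  have hc2' : (-1 : F) ≠ -2 := by
    intro h; exact one_ne_zero (α := F) (by linear_combination h)
  refine admitsStronglyReal_of_companionTriples hcop
    (companionTriple_generates ?_ fun H hW hs ↦ eq_top_of_card_prime hpr hW hs hl)
    (unipotentTriple_generates (c := (-1 : F)) fun H hW hs ↦
      eq_top_of_card_prime hpr hW hs (sub_ne_zero.mpr hc2.symm))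
    (?_ : (companionTriple (a : F) (b - a) 1 1).IsHyperbolic)
    (unipotentTriple_isHyperbolic h2 hc2 hc2') ?_
    (unipotentTriple_pow p (cube_eq_one_of_tr (by simp)))
  · rw [zpow_one]; exact Subgroup.mem_zpowers _
  · have h4 : 4 ≤ orderOf (companion (a : F)) :=
      four_le_orderOf_of_tr (by rw [tr_companion]; exact (ne2 _ d₁).1)
        (by rw [tr_companion]; exact (ne2 _ d₁).2) (by
          rw [tr_companion]
          intro h
          apply ha
          rw [← hcast]; push_cast; rw [h]; ring)
    refine isHyperbolic_of_orders (by rw [ex]; omega) ?_ ?_ (Or.inl (by rwa [ex]))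
    · rw [ey]
      exact three_le_orderOf_of_tr (by rw [tr_companion]; exact (ne2 _ d₂).1)
        (by rw [tr_companion]; exact (ne2 _ d₂).2)
    · rw [ez, orderOf_inv]
      exact three_le_orderOf_of_tr (by rw [tr_companion_mul_companion]; exact (ne2 _ d₃).1)
        (by rw [tr_companion_mul_companion]; exact (ne2 _ d₃).2)
  · rw [forall_mem_members, ex, ey, ez]
    refine ⟨pow _ (by rwa [tr_companion]), pow _ (by rwa [tr_companion]), ?_⟩
    rw [inv_pow, inv_eq_one]
    exact pow _ (by rwa [tr_companion_mul_companion])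

/-- In each case e is chosen with 3 not dividing p - e, and a, b so that the three discriminants
have quadratic character e. -/
theorem admitsStronglyReal_of_small_prime
    (h : Fintype.card F = 7 ∨ Fintype.card F = 11 ∨ Fintype.card F = 13 ∨ Fintype.card F = 17 ∨
      Fintype.card F = 19) : AdmitsStronglyRealBeauvilleStructure SL(2, F) := by
  rcases h with h | h | h | h | h
  · exact admitsStronglyReal_of_prime (by norm_num) (by norm_num) h 3 4 (-1) (by norm_num) 8
      (by norm_num) (by norm_num) (by norm_num) (by norm_num) (by norm_num) (by norm_num)
      (by norm_num)
  · exact admitsStronglyReal_of_prime (by norm_num) (by norm_num) h 3 7 1 (by norm_num) 10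
      (by norm_num) (by norm_num) (by norm_num) (by norm_num) (by norm_num) (by norm_num)
      (by norm_num)
  · exact admitsStronglyReal_of_prime (by norm_num) (by norm_num) h 3 6 (-1) (by norm_num) 14
      (by norm_num) (by norm_num) (by norm_num) (by norm_num) (by norm_num) (by norm_num)
      (by norm_num)
  · exact admitsStronglyReal_of_prime (by norm_num) (by norm_num) h 5 6 1 (by norm_num) 16
      (by norm_num) (by norm_num) (by norm_num) (by norm_num) (by norm_num) (by norm_num)
      (by norm_num)
  · exact admitsStronglyReal_of_prime (by norm_num) (by norm_num) h 4 8 (-1) (by norm_num) 20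
      (by norm_num) (by norm_num) (by norm_num) (by norm_num) (by norm_num) (by norm_num)
      (by norm_num)

end SpecialLinearTwo

/-! ### The case q = 9. -/

namespace SpecialLinearTwo

section

variable {F : Type*} [Field F]

/-- The matrix with the given entries. -/
def ofEntries (a b c d : F) (h : a * d - b * c = 1) : SL(2, F) :=
  ⟨!![a, b; c, d], by rwa [Matrix.det_fin_two_of]⟩

lemma ofEntries_mul {a b c d a' b' c' d' : F} (h : a * d - b * c = 1)
    (h' : a' * d' - b' * c' = 1) :
    ofEntries a b c d h * ofEntries a' b' c' d' h' =
      ofEntries (a * a' + b * c') (a * b' + b * d') (c * a' + d * c') (c * b' + d * d')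
        (by linear_combination h + (a * d - b * c) * h') := by
  apply ext_entries <;> rw [mul_apply_two] <;> rfl

lemma ofEntries_inv {a b c d : F} (h : a * d - b * c = 1) :
    (ofEntries a b c d h)⁻¹ = ofEntries d (-b) (-c) a (by linear_combination h) := by
  obtain ⟨h₁, h₂, h₃, h₄⟩ := inv_entries (ofEntries a b c d h)
  apply ext_entries <;> simp only [h₁, h₂, h₃, h₄] <;> rfl

lemma ofEntries_inj {a b c d a' b' c' d' : F} (h : a * d - b * c = 1)
    (h' : a' * d' - b' * c' = 1) :
    ofEntries a b c d h = ofEntries a' b' c' d' h' ↔ a = a' ∧ b = b' ∧ c = c' ∧ d = d' := by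
  constructor
  · intro he
    exact ⟨congrArg (fun A : SL(2, F) ↦ A 0 0) he, congrArg (fun A : SL(2, F) ↦ A 0 1) he,
      congrArg (fun A : SL(2, F) ↦ A 1 0) he, congrArg (fun A : SL(2, F) ↦ A 1 1) he⟩
  · rintro ⟨h₁, h₂, h₃, h₄⟩
    exact ext_entries h₁ h₂ h₃ h₄

lemma pow_add_two_apply (A : SL(2, F)) (n : ℕ) (i j : Fin 2) :
    (A ^ (n + 2)) i j = tr A * (A ^ (n + 1)) i j - (A ^ n) i j := by
  have e := fun k l ↦ coe_mul_self_apply A k l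
  obtain ⟨o₁, o₂, o₃, o₄⟩ := one_entries (F := F)
  rw [pow_add, pow_two, pow_succ, mul_apply_two, mul_apply_two (A ^ n) A, e, e]
  fin_cases j
  · simp only [Fin.zero_eta, o₁, o₃]; ring
  · simp only [Fin.mk_one, o₂, o₄]; ring

/-- For such a trace t, X⁴ + X³ + X² + X + 1 = (X² - tX + 1)(X² + (1 + t)X + 1), so the
characteristic polynomial divides X⁵ - 1. -/
lemma pow_five_eq_one_of_tr {A : SL(2, F)} (h : tr A ^ 2 + tr A - 1 = 0) : A ^ 5 = 1 := by
  have key : ∀ i j, (A ^ 5) i j = (1 : SL(2, F)) i j := by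
    intro i j
    have e₂ := pow_add_two_apply A 0 i j
    have e₃ := pow_add_two_apply A 1 i j
    have e₄ := pow_add_two_apply A 2 i j
    have e₅ := pow_add_two_apply A 3 i j
    simp only [zero_add, pow_one, pow_zero, Nat.reduceAdd] at e₂ e₃ e₄ e₅
    grind
  exact ext_entries (key _ _) (key _ _) (key _ _) (key _ _)

lemma tr_ofEntries {a b c d : F} (h : a * d - b * c = 1) : tr (ofEntries a b c d h) = a + d := rfl

lemma shear_eq_ofEntries (l : F) : shear l = ofEntries 1 l 0 1 (by simp) := rfl

/-- Conjugation by the matrix `!![0, 1; v, 0]`, where `w = v⁻¹`, as a function. -/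
def twistFun {v w : F} (h : v * w = 1) (A : SL(2, F)) : SL(2, F) :=
  ofEntries (A 1 1) (w * A 1 0) (v * A 0 1) (A 0 0) (by
    linear_combination det_eq_one A - A 0 1 * A 1 0 * h)

lemma twistFun_twistFun {v w : F} (h : v * w = 1) (A : SL(2, F)) :
    twistFun h (twistFun h A) = A := by
  apply ext_entries
  · rfl
  · change w * (v * A 0 1) = _
    linear_combination A 0 1 * h
  · change v * (w * A 1 0) = _
    linear_combination A 1 0 * h
  · rfl

/-- Conjugation by the matrix `!![0, 1; v, 0]`, where `w = v⁻¹`. -/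
def twist {v w : F} (h : v * w = 1) : SL(2, F) ≃* SL(2, F) where
  toFun := twistFun h
  invFun := twistFun h
  left_inv := twistFun_twistFun h
  right_inv := twistFun_twistFun h
  map_mul' A B := by
    unfold twistFun
    rw [ofEntries_mul, ofEntries_inj, mul_apply_two, mul_apply_two, mul_apply_two, mul_apply_two]
    refine ⟨?_, ?_, ?_, ?_⟩
    · linear_combination -A 1 0 * B 0 1 * h
    · ring
    · ring
    · linear_combination -A 0 1 * B 1 0 * h

lemma twist_ofEntries {v w a b c d : F} (h : v * w = 1) (hd : a * d - b * c = 1)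
    (hc : c = -(v * b)) : twist h (ofEntries a b c d hd) = (ofEntries a b c d hd)⁻¹ := by
  rw [ofEntries_inv]
  change ofEntries d (w * c) (v * b) a (by linear_combination hd - b * c * h) = _
  rw [ofEntries_inj]
  refine ⟨rfl, ?_, ?_, rfl⟩
  · rw [hc]; linear_combination -b * h
  · rw [hc]; ring

end

variable {F : Type*} [Field F] [Fintype F]

/-- The shear parameters include 1 and i, which span F over its prime field; a lower transvection
then supplies a companion matrix. -/
lemma eq_top_of_card_nine (h9 : Fintype.card F = 9) {i : F} (hi : i ^ 2 = -1)
    {H : Subgroup SL(2, F)} (h₁ : shear 1 ∈ H) (h₂ : shear (1 + i) ∈ H)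
    (h₃ : ofEntries (1 : F) 0 1 1 (by simp) ∈ H) : H = ⊤ := by
  classical
  have h2 : (2 : F) ≠ 0 := two_ne_zero_of_odd_card (by rw [h9]; decide)
  have m₁ : (1 : F) ∈ shearParams H := h₁
  have m₂ : i ∈ shearParams H := by
    have : i = (1 + i) - 1 := by ring
    rw [this]; exact sub_mem h₂ h₁
  have htop : shearParams H = ⊤ := by
    have hdvd : Nat.card (shearParams H) ∣ 3 ^ 2 := by
      have := AddSubgroup.card_addSubgroup_dvd_card (shearParams H)
      rwa [Nat.card_eq_fintype_card (α := F), h9] at this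
    obtain ⟨k, hk, hc⟩ := (Nat.dvd_prime_pow Nat.prime_three).mp hdvd
    have h4 : 4 ≤ Nat.card (shearParams H) := by
      let s : Finset F := {0, 1, -1, i}
      have n1 : (1 : F) ≠ -1 := fun h ↦ h2 (by linear_combination h)
      have n2 : i ≠ 0 := by rintro rfl; simp at hi
      have n3 : i ≠ 1 := by rintro rfl; exact n1 (by linear_combination hi)
      have n4 : i ≠ -1 := by rintro rfl; exact n1 (by linear_combination hi)
      have hs : s.card = 4 := by
        simp [s, n1, n2.symm, n3.symm, n4.symm]
      have hsub : ∀ x : s, (x : F) ∈ shearParams H := by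
        rintro ⟨x, hx⟩
        simp only [s, Finset.mem_insert, Finset.mem_singleton] at hx
        rcases hx with rfl | rfl | rfl | rfl
        · exact zero_mem _
        · exact m₁
        · exact neg_mem m₁
        · exact m₂
      rw [← hs, ← Fintype.card_coe, ← Nat.card_eq_fintype_card]
      exact Nat.card_le_card_of_injective
        (fun x : s ↦ (⟨x, hsub x⟩ : shearParams H)) fun x y hxy ↦ Subtype.ext
          (congrArg (fun u : shearParams H ↦ (u : F)) hxy)
    have : k = 2 := by
      interval_cases k <;> omega
    subst this
    apply AddSubgroup.eq_top_of_card_eq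
    rw [hc, Nat.card_eq_fintype_card, h9]
    norm_num
  refine eq_top_of_shears (fun l ↦ by rw [← mem_shearParams, htop]; trivial) (a := 0) ?_
  have : companion (0 : F) = (shear 1)⁻¹ * ofEntries 1 0 1 1 (by simp) * (shear 1)⁻¹ := by
    change ofEntries 0 (-1) 1 0 (by simp) = _
    rw [shear_eq_ofEntries, ofEntries_inv, ofEntries_mul, ofEntries_mul, ofEntries_inj]
    refine ⟨?_, ?_, ?_, ?_⟩ <;> ring
  rw [this]
  exact mul_mem (mul_mem (inv_mem h₁) h₃) (inv_mem h₁)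

theorem admitsStronglyReal_of_card_nine (h9 : Fintype.card F = 9) :
    AdmitsStronglyRealBeauvilleStructure SL(2, F) := by
  have hodd : Odd (Fintype.card F) := by rw [h9]; decide
  have h2 := two_ne_zero_of_odd_card hodd
  have h3 : (3 : F) = 0 := by
    have : ((Fintype.card F : ℕ) : F) = 0 := Nat.cast_card_eq_zero F
    rw [h9] at this
    have h33 : (3 : F) * 3 = 0 := by rw [← this]; norm_num
    exact mul_self_eq_zero.mp h33
  obtain ⟨i, hi⟩ : ∃ i : F, i ^ 2 = -1 := by
    obtain ⟨i, hi⟩ := FiniteField.isSquare_neg_one_iff.mpr (by rw [h9]; decide : Fintype.card F % 4 ≠ 3)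
    exact ⟨i, by rw [pow_two, hi]⟩
  have n1 : (1 : F) ≠ -1 := fun h ↦ h2 (by linear_combination h)
  have n2 : i ≠ 0 := by rintro rfl; simp at hi
  have n3 : i ≠ 1 := by rintro rfl; exact n1 (by linear_combination hi)
  have n4 : i ≠ -1 := by rintro rfl; exact n1 (by linear_combination hi)
  -- `twist` inverts exactly the matrices with c = -vb. With v = 1 + i this holds for all four
  -- generators below, so one automorphism serves both triples. Trace i gives exponent 8 and trace 1
  -- - i gives exponent 5.
  have hv : (1 + i) * (i - 1) = 1 := by linear_combination hi - h3
  obtain ⟨x₁, hx₁⟩ : ∃ x : SL(2, F), x = ofEntries 1 i (1 + 2 * i) (2 + i) (by grind) := ⟨_, rfl⟩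
  obtain ⟨y₁, hy₁⟩ : ∃ y : SL(2, F), y = ofEntries 2 (2 + i) 2 (1 + i) (by grind) := ⟨_, rfl⟩
  obtain ⟨x₂, hx₂⟩ : ∃ x : SL(2, F), x = ofEntries i i (1 + 2 * i) (1 + i) (by grind) := ⟨_, rfl⟩
  obtain ⟨y₂, hy₂⟩ : ∃ y : SL(2, F), y = ofEntries (2 * i) 1 (2 + 2 * i) 1 (by grind) := ⟨_, rfl⟩
  have tx₁ : tr x₁ = i := by rw [hx₁, tr_ofEntries]; grind
  have ty₁ : tr y₁ = i := by rw [hy₁, tr_ofEntries]; grind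
  have tz₁ : tr (x₁ * y₁)⁻¹ = i := by rw [tr_inv, hx₁, hy₁, ofEntries_mul, tr_ofEntries]; grind
  have tx₂ : tr x₂ = 1 - i := by rw [hx₂, tr_ofEntries]; grind
  have ty₂ : tr y₂ = 1 - i := by rw [hy₂, tr_ofEntries]; grind
  have tz₂ : tr (x₂ * y₂)⁻¹ = 1 - i := by
    rw [tr_inv, hx₂, hy₂, ofEntries_mul, tr_ofEntries]; grind
  have pow₁ : ∀ A : SL(2, F), tr A = i → A ^ 8 = 1 := by
    intro A hA
    have := pow_of_discriminant (by rw [Nat.card_eq_fintype_card, h9]) (h9 ▸ hodd) A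
      (e := 1) (Or.inl rfl) (by rw [hA]; norm_num; grind)
    exact_mod_cast this
  have pow₂ : ∀ A : SL(2, F), tr A = 1 - i → A ^ 5 = 1 := fun A hA ↦
    pow_five_eq_one_of_tr (by rw [hA]; grind)
  have ord₁ : ∀ A : SL(2, F), tr A = i → 4 ≤ orderOf A := fun A hA ↦
    four_le_orderOf_of_tr (by rw [hA]; grind) (by rw [hA]; grind) (by rw [hA]; grind)
  have ord₂ : ∀ A : SL(2, F), tr A = 1 - i → 4 ≤ orderOf A := fun A hA ↦
    four_le_orderOf_of_tr (by rw [hA]; grind) (by rw [hA]; grind) (by rw [hA]; grind)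
  have hyp : ∀ (x y : SL(2, F)) (t : F), (∀ A : SL(2, F), tr A = t → 4 ≤ orderOf A) → tr x = t →
      tr y = t → tr (x * y)⁻¹ = t → GroupTriple.IsHyperbolic ⟨x, y, (x * y)⁻¹⟩ :=
    fun x y t h hx hy hz ↦ isHyperbolic_of_orders (by linarith [h _ hx]) (by linarith [h _ hy])
      (by linarith [h _ hz]) (Or.inl (h _ hx))
  have gen : ∀ x y : SL(2, F), (∀ H : Subgroup SL(2, F), x ∈ H → y ∈ H → H = ⊤) →
      GroupTriple.Generates ⟨x, y, (x * y)⁻¹⟩ := fun x y h ↦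
    h _ (Subgroup.subset_closure (by simp [GroupTriple.members]))
      (Subgroup.subset_closure (by simp [GroupTriple.members]))
  refine ⟨⟨x₁, y₁, (x₁ * y₁)⁻¹⟩, ⟨x₂, y₂, (x₂ * y₂)⁻¹⟩, ⟨⟨?_, ?_, mul_inv_cancel _, mul_inv_cancel _,
    hyp _ _ _ ord₁ tx₁ ty₁ tz₁, hyp _ _ _ ord₂ tx₂ ty₂ tz₂, ?_⟩, twist hv, twist hv, ⟨1, by simp⟩,
    Or.inl ⟨?_, ?_⟩, Or.inl ⟨?_, ?_⟩⟩⟩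
  · refine gen _ _ fun H hx hy ↦ eq_top_of_card_nine h9 hi ?_ ?_ ?_
    -- Explicit words in the generators express the transvections required by `eq_top_of_card_nine`.
    · have : shear 1 = x₁ * y₁⁻¹ * x₁⁻¹ * y₁ * y₁ := by
        rw [hx₁, hy₁]
        simp only [ofEntries_inv, ofEntries_mul, ofEntries_inj, shear_eq_ofEntries]
        refine ⟨?_, ?_, ?_, ?_⟩ <;> grind
      rw [this]
      exact mul_mem (mul_mem (mul_mem (mul_mem hx (inv_mem hy)) (inv_mem hx)) hy) hy
    · have : shear (1 + i) = x₁ * y₁ * x₁⁻¹ * y₁⁻¹ * x₁ := by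
        rw [hx₁, hy₁]
        simp only [ofEntries_inv, ofEntries_mul, ofEntries_inj, shear_eq_ofEntries]
        refine ⟨?_, ?_, ?_, ?_⟩ <;> grind
      rw [this]
      exact mul_mem (mul_mem (mul_mem (mul_mem hx hy) (inv_mem hx)) (inv_mem hy)) hx
    · have : ofEntries (1 : F) 0 1 1 (by simp) = x₁ * y₁ * x₁⁻¹ * x₁⁻¹ * y₁⁻¹ := by
        rw [hx₁, hy₁]
        simp only [ofEntries_inv, ofEntries_mul, ofEntries_inj]
        refine ⟨?_, ?_, ?_, ?_⟩ <;> grind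
      rw [this]
      exact mul_mem (mul_mem (mul_mem (mul_mem hx hy) (inv_mem hx)) (inv_mem hx)) (inv_mem hy)
  · refine gen _ _ fun H hx hy ↦ eq_top_of_card_nine h9 hi ?_ ?_ ?_
    · have : shear 1 = x₂⁻¹ * y₂ * x₂⁻¹ * y₂⁻¹ * y₂⁻¹ * x₂⁻¹ := by
        rw [hx₂, hy₂]
        simp only [ofEntries_inv, ofEntries_mul, ofEntries_inj, shear_eq_ofEntries]
        refine ⟨?_, ?_, ?_, ?_⟩ <;> grind
      rw [this]
      exact mul_mem (mul_mem (mul_mem (mul_mem (mul_mem (inv_mem hx) hy) (inv_mem hx))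
        (inv_mem hy)) (inv_mem hy)) (inv_mem hx)
    · have : shear (1 + i) = y₂⁻¹ * y₂⁻¹ * x₂⁻¹ * x₂⁻¹ * y₂ * x₂ := by
        rw [hx₂, hy₂]
        simp only [ofEntries_inv, ofEntries_mul, ofEntries_inj, shear_eq_ofEntries]
        refine ⟨?_, ?_, ?_, ?_⟩ <;> grind
      rw [this]
      exact mul_mem (mul_mem (mul_mem (mul_mem (mul_mem (inv_mem hy) (inv_mem hy)) (inv_mem hx))
        (inv_mem hx)) hy) hx
    · have : ofEntries (1 : F) 0 1 1 (by simp) = y₂⁻¹ * x₂ * y₂⁻¹ * y₂⁻¹ * x₂⁻¹ * x₂⁻¹ := by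
        rw [hx₂, hy₂]
        simp only [ofEntries_inv, ofEntries_mul, ofEntries_inj]
        refine ⟨?_, ?_, ?_, ?_⟩ <;> grind
      rw [this]
      exact mul_mem (mul_mem (mul_mem (mul_mem (mul_mem (inv_mem hy) hx) (inv_mem hy))
        (inv_mem hy)) (inv_mem hx)) (inv_mem hx)
  · have m₁ : ∀ g ∈ GroupTriple.members ⟨x₁, y₁, (x₁ * y₁)⁻¹⟩, g ^ 8 = 1 := by
      rw [forall_mem_members]; exact ⟨pow₁ _ tx₁, pow₁ _ ty₁, pow₁ _ tz₁⟩
    have m₂ : ∀ g ∈ GroupTriple.members ⟨x₂, y₂, (x₂ * y₂)⁻¹⟩, g ^ 5 = 1 := by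
      rw [forall_mem_members]; exact ⟨pow₂ _ tx₂, pow₂ _ ty₂, pow₂ _ tz₂⟩
    exact fun a ha b hb ↦ not_isConj_of_coprime (by norm_num) (m₁ a ha) (m₂ b hb)
  all_goals
    simp only [hx₁, hy₁, hx₂, hy₂]
    exact twist_ofEntries hv _ (by grind)

end SpecialLinearTwo

/-! ### Obstructions to Beauville structures and to generation. -/

namespace SpecialLinearTwo

section Groups

variable {G : Type*} [Group G]

lemma exists_four_le_orderOf [Finite G] {t : GroupTriple G} (h : t.IsHyperbolic) :
    ∃ g ∈ t.members, 4 ≤ orderOf g := by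
  by_contra! hlt
  rw [forall_mem_members] at hlt
  have third : ∀ g : G, orderOf g < 4 → (3 : ℚ)⁻¹ ≤ (orderOf g : ℚ)⁻¹ := fun g hg ↦ by
    have := orderOf_pos g
    gcongr
    exact_mod_cast Nat.le_of_lt_succ hg
  have := third _ hlt.1
  have := third _ hlt.2.1
  have := third _ hlt.2.2
  rw [GroupTriple.IsHyperbolic] at h
  linarith

lemma orderOf_lt_four {g : G} {n : ℕ} (hn : 0 < n) (hn4 : n < 4) (h : g ^ n = 1) :
    orderOf g < 4 :=
  (orderOf_le_of_pow_eq_one hn h).trans_lt hn4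

/-- If a prime divides the order of the group exactly once, then elements of that order are
conjugate to powers of each other. -/
lemma exists_isConj_zpow [Finite G] {p : ℕ} [hp : Fact p.Prime]
    (hG : (Nat.card G).factorization p = 1) {a b : G} (ha : a ^ p = 1) (ha1 : a ≠ 1)
    (hb : b ^ p = 1) (hb1 : b ≠ 1) : ∃ j : ℤ, IsConj a (b ^ j) := by
  let P : Sylow p G := Sylow.ofCard (Subgroup.zpowers a) (by
    rw [Nat.card_zpowers, orderOf_eq_prime ha ha1, hG, pow_one])
  let Q : Sylow p G := Sylow.ofCard (Subgroup.zpowers b) (by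
    rw [Nat.card_zpowers, orderOf_eq_prime hb hb1, hG, pow_one])
  obtain ⟨g, hg⟩ := MulAction.exists_smul_eq G P Q
  have hmem : g * a * g⁻¹ ∈ Q := by
    rw [← hg]
    have : a ∈ P := Subgroup.mem_zpowers a
    exact Subgroup.smul_mem_pointwise_smul _ (MulAut.conj g) _ this
  obtain ⟨j, hj⟩ : g * a * g⁻¹ ∈ Subgroup.zpowers b := hmem
  exact ⟨j, isConj_iff.mpr ⟨g, hj.symm⟩⟩

end Groups

section Beauville

variable {G : Type*} [Group G] {t₁ t₂ : GroupTriple G}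

lemma isBeauvilleStructure_symm (h : IsBeauvilleStructure t₁ t₂) : IsBeauvilleStructure t₂ t₁ :=
  ⟨h.generates₂, h.generates₁, h.mul_eq_one₂, h.mul_eq_one₁, h.hyperbolic₂, h.hyperbolic₁,
    fun a ha b hb i j hi hc ↦ h.not_isConj b hb a ha j i
      (fun hj ↦ hi (by rw [hj] at hc; exact isConj_one_left.mp hc)) hc.symm⟩

/-- Meant for c = -1, the central involution in odd characteristic. -/
lemma pow_ne_pow (h : IsBeauvilleStructure t₁ t₂) {a b c : G} (ha : a ∈ t₁.members)
    (hb : b ∈ t₂.members) (hc : c ≠ 1) {m n : ℕ} (hm : a ^ m = c) : b ^ n ≠ c := by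
  rintro rfl
  refine h.not_isConj a ha b hb m n ?_ ?_
  · rw [zpow_natCast, hm]; exact hc
  · rw [zpow_natCast, zpow_natCast, hm]

/-- A prime dividing |G| exactly once can divide the orders of members of only one of the two
triples. -/
lemma pow_eq_one_of_factorization [Finite G] (h : IsBeauvilleStructure t₁ t₂) {p : ℕ}
    [Fact p.Prime] (hG : (Nat.card G).factorization p = 1) {a b : G} (ha : a ∈ t₁.members)
    (hb : b ∈ t₂.members) (m n : ℕ) (hap : (a ^ m) ^ p = 1) (ha1 : a ^ m ≠ 1)
    (hbp : (b ^ n) ^ p = 1) : b ^ n = 1 := by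
  by_contra hb1
  obtain ⟨j, hj⟩ := exists_isConj_zpow hG hap ha1 hbp hb1
  refine h.not_isConj a ha b hb m (n * j) ?_ ?_
  · rwa [zpow_natCast]
  · rwa [zpow_natCast, zpow_mul, zpow_natCast]

end Beauville

section Card

variable {F : Type*} [Field F] [Fintype F]

/-- Both sides are |GL_2(q)|, the left one through the determinant map. -/
lemma card_mul_card_units :
    Nat.card SL(2, F) * (Fintype.card F - 1) =
      (Fintype.card F ^ 2 - 1) * (Fintype.card F ^ 2 - Fintype.card F) := by
  classical
  have h := Subgroup.card_mul_index (Matrix.GeneralLinearGroup.det (n := Fin 2) (R := F)).ker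
  have hsurj : Function.Surjective (Matrix.GeneralLinearGroup.det (n := Fin 2) (R := F)) := by
    intro u
    refine ⟨Matrix.GeneralLinearGroup.mkOfDetNeZero !![(u : F), 0; 0, 1] (by simp), ?_⟩
    ext
    simp [Matrix.GeneralLinearGroup.mkOfDetNeZero]
  have hker : Nat.card (Matrix.GeneralLinearGroup.det (n := Fin 2) (R := F)).ker =
      Nat.card SL(2, F) := by
    refine (Nat.card_congr (Equiv.ofBijective
      (fun A : SL(2, F) ↦ (⟨Matrix.SpecialLinearGroup.toGL A, ?_⟩ :
        (Matrix.GeneralLinearGroup.det (n := Fin 2) (R := F)).ker)) ⟨?_, ?_⟩)).symm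
    · rw [MonoidHom.mem_ker]
      ext
      exact A.2
    · intro A B hAB
      exact Matrix.SpecialLinearGroup.toGL_injective (congrArg Subtype.val hAB)
    · rintro ⟨g, hg⟩
      rw [MonoidHom.mem_ker] at hg
      refine ⟨⟨g.1, congrArg Units.val hg⟩, ?_⟩
      apply Subtype.ext
      ext
      rfl
  rw [Subgroup.index_ker, MonoidHom.range_eq_top.mpr hsurj, Subgroup.card_top,
    Nat.card_eq_fintype_card (α := Fˣ), Fintype.card_units, hker, Matrix.card_GL_field] at h
  rw [h]
  simp [Fin.prod_univ_two]

end Card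

section Generation

variable {F : Type*} [Field F]

lemma closure_pair_of_generates {G : Type*} [Group G] {t : GroupTriple G} (hg : t.Generates)
    (ht : t.x * t.y * t.z = 1) : Subgroup.closure {t.x, t.y} = ⊤ := by
  rw [← top_le_iff, ← show _ = _ from hg, Subgroup.closure_le]
  have hx : t.x ∈ Subgroup.closure {t.x, t.y} := Subgroup.subset_closure (by simp)
  have hy : t.y ∈ Subgroup.closure {t.x, t.y} := Subgroup.subset_closure (by simp)
  intro g hgm
  revert g
  rw [forall_mem_members]
  refine ⟨hx, hy, ?_⟩
  rw [eq_inv_of_mul_eq_one_right ht]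
  exact inv_mem (mul_mem hx hy)

lemma shear_mul_lower_ne : shear (1 : F) * ofEntries 1 0 1 1 (by simp) ≠
    ofEntries (1 : F) 0 1 1 (by simp) * shear 1 := by
  rw [shear_eq_ofEntries, ofEntries_mul, ofEntries_mul, Ne, ofEntries_inj]
  simp

lemma not_commute_of_closure {A B : SL(2, F)} (h : Subgroup.closure {A, B} = ⊤) :
    A * B ≠ B * A := by
  intro hc
  have hcomm : ∀ x ∈ ({A, B} : Set SL(2, F)), ∀ y ∈ ({A, B} : Set SL(2, F)), x * y = y * x := by
    rintro x (rfl | rfl) y (rfl | rfl)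
    exacts [rfl, hc, hc.symm, rfl]
  have := Subgroup.isMulCommutative_closure hcomm
  refine shear_mul_lower_ne (F := F) ?_
  have hm : ∀ g : SL(2, F), g ∈ Subgroup.closure {A, B} := fun g ↦ h ▸ Subgroup.mem_top g
  exact setLike_mul_comm (hm _) (hm _)

/-- The vector `(p, q)` is an eigenvector of `A`. -/
def HasEigenvector (p q : F) (A : SL(2, F)) : Prop :=
  ∃ c, A 0 0 * p + A 0 1 * q = c * p ∧ A 1 0 * p + A 1 1 * q = c * q

lemma hasEigenvector_of_mul_eq {p q : F} (hpq : p ≠ 0 ∨ q ≠ 0) {A : SL(2, F)}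
    (h : q * (A 0 0 * p + A 0 1 * q) = p * (A 1 0 * p + A 1 1 * q)) : HasEigenvector p q A := by
  rcases hpq with hp | hq
  · refine ⟨(A 0 0 * p + A 0 1 * q) / p, by field_simp, ?_⟩
    field_simp
    linear_combination -h
  · refine ⟨(A 1 0 * p + A 1 1 * q) / q, ?_, by field_simp⟩
    field_simp
    linear_combination h

lemma closure_ne_top_of_hasEigenvector {p q : F} (hpq : p ≠ 0 ∨ q ≠ 0) {S : Set SL(2, F)}
    (hS : ∀ A ∈ S, HasEigenvector p q A) : Subgroup.closure S ≠ ⊤ := by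
  intro h
  have key : ∀ A : SL(2, F), HasEigenvector p q A := by
    intro A
    have hA : A ∈ Subgroup.closure S := h ▸ Subgroup.mem_top A
    induction hA using Subgroup.closure_induction with
    | mem A hA => exact hS A hA
    | one =>
      obtain ⟨o₁, o₂, o₃, o₄⟩ := one_entries (F := F)
      exact ⟨1, by rw [o₁, o₂]; ring, by rw [o₃, o₄]; ring⟩
    | mul A B _ _ hA hB =>
      obtain ⟨c, h₁, h₂⟩ := hA
      obtain ⟨d, h₃, h₄⟩ := hB
      refine ⟨c * d, ?_, ?_⟩
      · rw [mul_apply_two, mul_apply_two]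
        linear_combination A 0 0 * h₃ + A 0 1 * h₄ + d * h₁
      · rw [mul_apply_two, mul_apply_two]
        linear_combination A 1 0 * h₃ + A 1 1 * h₄ + d * h₂
    | inv A _ hA =>
      obtain ⟨c, h₁, h₂⟩ := hA
      obtain ⟨o₁, o₂, o₃, o₄⟩ := inv_entries A
      refine ⟨tr A - c, ?_, ?_⟩
      · rw [o₁, o₂, tr]; linear_combination -h₁
      · rw [o₃, o₄, tr]; linear_combination -h₂
  obtain ⟨c, h₁, h₂⟩ := key (shear 1)
  obtain ⟨d, h₃, h₄⟩ := key (ofEntries 1 0 1 1 (by simp))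
  change 1 * p + 1 * q = c * p at h₁
  change 0 * p + 1 * q = c * q at h₂
  change 1 * p + 0 * q = d * p at h₃
  change 1 * p + 1 * q = d * q at h₄
  have hq : q = 0 := by
    by_contra hq
    have : c = 1 := mul_right_cancel₀ hq (by linear_combination -h₂)
    exact hq (by rw [this] at h₁; linear_combination h₁)
  have hp : p = 0 := by
    rw [hq] at h₄
    linear_combination h₄
  exact hpq.elim (· hp) (· hq)

/-- If the trace of the commutator of `A` and `B` is `2`, then `A` and `B` do not generate. -/
lemma fricke_ne_zero {A B : SL(2, F)} (h : Subgroup.closure {A, B} = ⊤) :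
    tr A ^ 2 + tr B ^ 2 + tr (A * B) ^ 2 - tr A * tr B * tr (A * B) - 4 ≠ 0 := by
  intro h0
  have dA := det_eq_one A
  have dB := det_eq_one B
  have hc := not_commute_of_closure h
  simp only [tr, mul_apply_two] at h0
  -- C = AB - BA has rows (n, m) and (k, -n), and the hypothesis says det C = 0, so C is nilpotent.
  -- With tr(AC) = tr(BC) = 0 this makes the image of C, spanned by a nonzero column, a common
  -- eigenline of A and B.
  obtain ⟨n, hn⟩ : ∃ n, n = A 0 1 * B 1 0 - B 0 1 * A 1 0 := ⟨_, rfl⟩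
  obtain ⟨m, hm⟩ : ∃ m, m = A 0 0 * B 0 1 + A 0 1 * B 1 1 - (B 0 0 * A 0 1 + B 0 1 * A 1 1) :=
    ⟨_, rfl⟩
  obtain ⟨k, hk⟩ : ∃ k, k = A 1 0 * B 0 0 + A 1 1 * B 1 0 - (B 1 0 * A 0 0 + B 1 1 * A 1 0) :=
    ⟨_, rfl⟩
  have hN : n ^ 2 + m * k = 0 := by
    rw [hn, hm, hk]
    generalize A 0 0 = a, A 0 1 = b, A 1 0 = c, A 1 1 = d at *
    generalize B 0 0 = a', B 0 1 = b', B 1 0 = c', B 1 1 = d' at *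
    grind
  have hA : A 0 0 * n + A 0 1 * k + A 1 0 * m - A 1 1 * n = 0 := by rw [hn, hm, hk]; ring
  have hB : B 0 0 * n + B 0 1 * k + B 1 0 * m - B 1 1 * n = 0 := by rw [hn, hm, hk]; ring
  by_cases hk0 : n = 0 ∧ k = 0
  · have hm0 : m ≠ 0 := by
      intro hm0
      apply hc
      apply ext_entries <;> simp only [mul_apply_two]
      · linear_combination hk0.1 - hn
      · linear_combination hm0 - hm
      · linear_combination hk0.2 - hk
      · linear_combination hn - hk0.1
    refine closure_ne_top_of_hasEigenvector (p := m) (q := -n) (Or.inl hm0) ?_ h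
    rw [hk0.1, hk0.2] at hA hB
    rintro g (rfl | rfl) <;> apply hasEigenvector_of_mul_eq (Or.inl hm0) <;> rw [hk0.1]
    · linear_combination (-m) * hA
    · linear_combination (-m) * hB
  · have hnk : n ≠ 0 ∨ k ≠ 0 := by tauto
    refine closure_ne_top_of_hasEigenvector (p := n) (q := k) hnk ?_ h
    rintro g (rfl | rfl) <;> apply hasEigenvector_of_mul_eq hnk
    · linear_combination k * hA - g 1 0 * hN
    · linear_combination k * hB - g 1 0 * hN

end Generation

end SpecialLinearTwo

/-! ### Non-existence for q ≤ 5, and assembly. -/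

namespace SpecialLinearTwo

section

variable {F : Type*} [Field F]

lemma tr_neg (A : SL(2, F)) : tr (-A) = -tr A := by
  simp only [tr, Matrix.SpecialLinearGroup.coe_neg, Matrix.neg_apply]; ring

lemma cube_eq_neg_one_of_tr {A : SL(2, F)} (h : tr A = 1) : A ^ 3 = -1 := by
  have := cube_eq_one_of_tr (A := -A) (by rw [tr_neg, h])
  rw [Odd.neg_pow (by decide)] at this
  rw [← this, neg_neg]

lemma neg_one_ne_one (h2 : (2 : F) ≠ 0) : (-1 : SL(2, F)) ≠ 1 := by
  intro h
  have := congrArg tr h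
  rw [tr_neg, tr_one] at this
  have h4 : (2 : F) * 2 = 0 := by linear_combination -this
  exact h2 (mul_self_eq_zero.mp h4)

lemma eq_neg_one_of_sq_eq_one (h2 : (2 : F) ≠ 0) {A : SL(2, F)} (h : A ^ 2 = 1)
    (ht : tr A = -2) : A = -1 := by
  have key : ∀ i j, A i j = -(1 : SL(2, F)) i j := by
    intro i j
    have e := coe_mul_self_apply A i j
    rw [← pow_two, h, ht] at e
    apply mul_left_cancel₀ h2
    linear_combination e
  apply ext_entries <;> rw [key, Matrix.SpecialLinearGroup.coe_neg, Matrix.neg_apply]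

section Triples

variable {t : GroupTriple SL(2, F)}

lemma fricke_triple_ne_zero (hg : t.Generates) (ht : t.x * t.y * t.z = 1) :
    tr t.x ^ 2 + tr t.y ^ 2 + tr t.z ^ 2 - tr t.x * tr t.y * tr t.z - 4 ≠ 0 := by
  have := fricke_ne_zero (closure_pair_of_generates hg ht)
  rwa [eq_inv_of_mul_eq_one_left ht, tr_inv] at this

/-- The members of a generating triple with product one are not scalar. -/
lemma member_ne_scalar (hg : t.Generates) (ht : t.x * t.y * t.z = 1) :
    ∀ g ∈ t.members, g ≠ 1 ∧ g ≠ -1 := by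
  -- If one member is ±1, the other two traces agree up to that sign, and the Fricke expression
  -- vanishes.
  have hf := fricke_triple_ne_zero hg ht
  have two : ∀ {g : SL(2, F)}, (g = 1 ∨ g = -1) → ∀ A B : SL(2, F), g * A * B = 1 →
      (tr g = 2 ∧ tr A = tr B) ∨ (tr g = -2 ∧ tr A = -tr B) := by
    rintro g (rfl | rfl) A B h
    · left
      rw [one_mul] at h
      exact ⟨tr_one, by rw [eq_inv_of_mul_eq_one_left h, tr_inv]⟩
    · right
      rw [neg_one_mul] at h
      refine ⟨by rw [tr_neg, tr_one], ?_⟩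
      rw [← neg_neg (tr A), ← tr_neg A, eq_inv_of_mul_eq_one_left h, tr_inv]
  have hyz : t.y * t.z * t.x = 1 := by
    rw [mul_assoc] at ht
    exact mul_eq_one_iff_eq_inv.mpr (inv_eq_of_mul_eq_one_right ht).symm
  have hzx : t.z * t.x * t.y = 1 := by
    rw [mul_assoc] at hyz
    exact mul_eq_one_iff_eq_inv.mpr (inv_eq_of_mul_eq_one_right hyz).symm
  simp only [← not_or]
  rw [forall_mem_members]
  refine ⟨fun h ↦ hf ?_, fun h ↦ hf ?_, fun h ↦ hf ?_⟩
  · rcases two h _ _ ht with ⟨h₁, h₂⟩ | ⟨h₁, h₂⟩ <;> rw [h₁, h₂] <;> ring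
  · rcases two h _ _ hyz with ⟨h₁, h₂⟩ | ⟨h₁, h₂⟩ <;> rw [h₁, h₂] <;> ring
  · rcases two h _ _ hzx with ⟨h₁, h₂⟩ | ⟨h₁, h₂⟩ <;> rw [h₁, h₂] <;> ring

/-- A triple of elements of trace zero generates at most a quaternion group. -/
lemma not_generates_of_tr_zero (h2 : (2 : F) ≠ 0) (ht : t.x * t.y * t.z = 1)
    (h : ∀ g ∈ t.members, tr g = 0) : ¬ t.Generates := by
  intro hg
  have hcl := closure_pair_of_generates hg ht
  rw [forall_mem_members] at h
  obtain ⟨hx, hy, hz⟩ := h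
  -- x, y and xy all square to -1, so x and y anticommute. Then every element of the group commutes
  -- or anticommutes with x, which fails for `shear 1`.
  have hanti : t.y * t.x = -(t.x * t.y) := by
    have hxy : (t.x * t.y) ^ 2 = -1 := by
      apply sq_eq_neg_one_of_tr
      rw [eq_inv_of_mul_eq_one_left ht, tr_inv, hz]
    have hx2 := sq_eq_neg_one_of_tr hx
    have hy2 := sq_eq_neg_one_of_tr hy
    calc t.y * t.x = t.x⁻¹ * (t.x * t.y) ^ 2 * t.y⁻¹ := by rw [pow_two]; group
      _ = -(t.x⁻¹ * t.y⁻¹) := by rw [hxy]; simp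
      _ = -(t.x * t.y) := by
        have ex : t.x⁻¹ = -t.x := inv_eq_of_mul_eq_one_right (by rw [mul_neg, ← pow_two, hx2, neg_neg])
        have ey : t.y⁻¹ = -t.y := inv_eq_of_mul_eq_one_right (by rw [mul_neg, ← pow_two, hy2, neg_neg])
        rw [ex, ey, neg_mul_neg]
  have key : ∀ g : SL(2, F), g * t.x = t.x * g ∨ g * t.x = -(t.x * g) := by
    intro g
    have hgm : g ∈ Subgroup.closure {t.x, t.y} := hcl ▸ Subgroup.mem_top g
    induction hgm using Subgroup.closure_induction with
    | mem g hg =>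
      rcases hg with rfl | rfl
      · exact Or.inl rfl
      · exact Or.inr hanti
    | one => simp
    | mul g k _ _ h₁ h₂ =>
      rcases h₁ with h₁ | h₁ <;> rcases h₂ with h₂ | h₂ <;>
        simp [mul_assoc, h₂, ← mul_assoc g, h₁]
    | inv g _ h =>
      rcases h with h | h
      · left
        rw [inv_mul_eq_iff_eq_mul, ← mul_assoc, h, mul_inv_cancel_right]
      · right
        rw [inv_mul_eq_iff_eq_mul, mul_neg, ← mul_assoc, h]
        simp
  have hd := det_eq_one t.x
  have htr : t.x 0 0 + t.x 1 1 = 0 := hx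
  rcases key (shear 1) with h | h
  · have e₀ := congrArg (fun A : SL(2, F) ↦ A 0 0) h
    have e₁ := congrArg (fun A : SL(2, F) ↦ A 0 1) h
    simp only [mul_apply_two] at e₀ e₁
    simp at e₀ e₁
    have : (2 : F) * t.x 0 0 = 0 := by linear_combination htr - e₁
    have h0 : t.x 0 0 = 0 := (mul_eq_zero.mp this).resolve_left h2
    rw [h0, e₀] at hd
    simp at hd
  · have e₀ := congrArg (fun A : SL(2, F) ↦ A 0 0) h
    have e₁ := congrArg (fun A : SL(2, F) ↦ A 1 0) h
    simp only [Matrix.SpecialLinearGroup.coe_neg, Matrix.neg_apply, mul_apply_two] at e₀ e₁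
    simp at e₀ e₁
    have h1 : t.x 1 0 = 0 := by
      have : (2 : F) * t.x 1 0 = 0 := by linear_combination e₁
      exact (mul_eq_zero.mp this).resolve_left h2
    have h0 : t.x 0 0 = 0 := by
      have : (2 : F) * t.x 0 0 = 0 := by linear_combination e₀ - h1
      exact (mul_eq_zero.mp this).resolve_left h2
    rw [h0, h1] at hd
    simp at hd

end Triples

end

variable {F : Type*} [Field F] [Fintype F]

theorem not_admits_of_card_two (h : Fintype.card F = 2) :
    ¬ AdmitsBeauvilleStructure SL(2, F) := by
  rintro ⟨t₁, t₂, ht⟩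
  obtain ⟨g, -, hg⟩ := exists_four_le_orderOf ht.hyperbolic₁
  have : CharP F 2 := charP_of_card_eq_prime h
  have h2 : (2 : F) = 0 := CharTwo.two_eq_zero
  have hcard := FiniteField.pow_card (tr g)
  rw [h] at hcard
  -- In F_2 these are 0 and 1: involutions or the identity, and elements of order 3.
  have htr : tr g = 2 ∨ tr g = -1 := by grind
  rcases htr with htr | htr
  · exact absurd (orderOf_lt_four (by norm_num) (by norm_num) (unipotent_pow_char g htr 2))
      (by omega)
  · exact absurd (orderOf_lt_four (by norm_num) (by norm_num) (cube_eq_one_of_tr htr)) (by omega)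

theorem not_admits_of_card_three (h : Fintype.card F = 3) :
    ¬ AdmitsBeauvilleStructure SL(2, F) := by
  rintro ⟨t₁, t₂, ht⟩
  have h2 : (2 : F) ≠ 0 := two_ne_zero_of_odd_card (by rw [h]; decide)
  have key : ∀ g : SL(2, F), 4 ≤ orderOf g → ∃ n : ℕ, g ^ n = -1 := by
    intro g hg
    have hcard := FiniteField.pow_card (tr g)
    rw [h] at hcard
    have htr : tr g = 0 ∨ tr g = 1 ∨ tr g = -1 := by grind
    rcases htr with htr | htr | htr
    · exact ⟨2, sq_eq_neg_one_of_tr htr⟩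
    · exact ⟨3, cube_eq_neg_one_of_tr htr⟩
    · exact absurd (orderOf_lt_four (by norm_num) (by norm_num) (cube_eq_one_of_tr htr)) (by omega)
  obtain ⟨a, ha, ha4⟩ := exists_four_le_orderOf ht.hyperbolic₁
  obtain ⟨b, hb, hb4⟩ := exists_four_le_orderOf ht.hyperbolic₂
  obtain ⟨m, hm⟩ := key a ha4
  obtain ⟨n, hn⟩ := key b hb4
  exact pow_ne_pow ht ha hb (neg_one_ne_one h2) hm hn

theorem not_admits_of_card_four (h : Fintype.card F = 4) :
    ¬ AdmitsBeauvilleStructure SL(2, F) := by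
  rintro ⟨t₁, t₂, ht⟩
  have h2 : (2 : F) = 0 := by
    have : ((Fintype.card F : ℕ) : F) = 0 := Nat.cast_card_eq_zero F
    rw [h] at this
    exact mul_self_eq_zero.mp (by rw [← this]; norm_num)
  have := CharTwo.of_one_ne_zero_of_two_eq_zero (R := F) one_ne_zero h2
  have key : ∀ g : SL(2, F), 4 ≤ orderOf g → g ^ 5 = 1 ∧ g ≠ 1 := by
    intro g hg
    have hcard := FiniteField.pow_card (tr g)
    rw [h] at hcard
    -- The factors of t⁴ - t in characteristic two, with 0 = 2 and 1 = -1.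
    have htr : tr g = 2 ∨ tr g = -1 ∨ tr g ^ 2 + tr g - 1 = 0 := by grind
    rcases htr with htr | htr | htr
    · exact absurd (orderOf_lt_four (by norm_num) (by norm_num) (unipotent_pow_char g htr 2))
        (by omega)
    · exact absurd (orderOf_lt_four (by norm_num) (by norm_num) (cube_eq_one_of_tr htr)) (by omega)
    · refine ⟨pow_five_eq_one_of_tr htr, ?_⟩
      rintro rfl
      simp at hg
  obtain ⟨a, ha, ha4⟩ := exists_four_le_orderOf ht.hyperbolic₁
  obtain ⟨b, hb, hb4⟩ := exists_four_le_orderOf ht.hyperbolic₂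
  have hG : Nat.card SL(2, F) = 5 * 12 := by
    have := card_mul_card_units (F := F)
    rw [h] at this
    omega
  have : Fact (Nat.Prime 5) := ⟨by norm_num⟩
  have hfac : (Nat.card SL(2, F)).factorization 5 = 1 := by
    rw [hG, Nat.factorization_mul (by norm_num) (by norm_num), Finsupp.add_apply,
      Nat.Prime.factorization_self (by norm_num), Nat.factorization_eq_zero_of_not_dvd (by norm_num)]
  have := pow_eq_one_of_factorization ht hfac ha hb 1 1 (by rw [pow_one]; exact (key a ha4).1)
    (by rw [pow_one]; exact (key a ha4).2) (by rw [pow_one]; exact (key b hb4).1)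
  exact (key b hb4).2 (by rwa [pow_one] at this)

/-- Elements of trace 0, 1 or -2 have -1 as a power, so one triple has only traces 2 and -1. The
Fricke expression vanishes at (2, 2, 2) and (-1, -1, -1), so that triple contains elements of orders
5 and 3. As 3 and 5 divide |G| = 120 once, the other triple is left with trace 0 throughout and
cannot generate. -/
theorem not_admits_of_card_five (h : Fintype.card F = 5) :
    ¬ AdmitsBeauvilleStructure SL(2, F) := by
  have h2 : (2 : F) ≠ 0 := two_ne_zero_of_odd_card (by rw [h]; decide)
  have : Fact (Nat.Prime 5) := ⟨by norm_num⟩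
  have : Fact (Nat.Prime 3) := ⟨by norm_num⟩
  have : CharP F 5 := charP_of_card_eq_prime h
  have h5 : (5 : F) = 0 := by exact_mod_cast CharP.cast_eq_zero F 5
  have hG : Nat.card SL(2, F) = 120 := by
    have := card_mul_card_units (F := F)
    rw [h] at this
    omega
  have fac5 : (Nat.card SL(2, F)).factorization 5 = 1 := by
    rw [hG, show 120 = 5 * 24 by norm_num, Nat.factorization_mul (by norm_num) (by norm_num),
      Finsupp.add_apply, Nat.Prime.factorization_self (by norm_num),
      Nat.factorization_eq_zero_of_not_dvd (by norm_num)]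
  have fac3 : (Nat.card SL(2, F)).factorization 3 = 1 := by
    rw [hG, show 120 = 3 * 40 by norm_num, Nat.factorization_mul (by norm_num) (by norm_num),
      Finsupp.add_apply, Nat.Prime.factorization_self (by norm_num),
      Nat.factorization_eq_zero_of_not_dvd (by norm_num)]
  have traces : ∀ g : SL(2, F), tr g = 0 ∨ tr g = 1 ∨ tr g = -1 ∨ tr g = 2 ∨ tr g = -2 := by
    intro g
    have hcard := FiniteField.pow_card (tr g)
    rw [h] at hcard
    have : tr g * ((tr g - 1) * ((tr g + 1) * ((tr g - 2) * (tr g + 2)))) = 0 := by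
      linear_combination hcard + (tr g - tr g ^ 3) * h5
    simp only [mul_eq_zero, sub_eq_zero, add_eq_zero_iff_eq_neg] at this
    exact this
  have hneg : ∀ g : SL(2, F), (tr g = 2 ∨ tr g = -1) ∨ ∃ n : ℕ, g ^ n = -1 := by
    intro g
    rcases traces g with ht | ht | ht | ht | ht
    · exact Or.inr ⟨2, sq_eq_neg_one_of_tr ht⟩
    · exact Or.inr ⟨3, cube_eq_neg_one_of_tr ht⟩
    · exact Or.inl (Or.inr ht)
    · exact Or.inl (Or.inl ht)
    · refine Or.inr ⟨5, ?_⟩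
      have := unipotent_pow_char (-g) (by rw [tr_neg, ht, neg_neg]) 5
      rw [Odd.neg_pow (by decide)] at this
      rw [← this, neg_neg]
  have key : ∀ t₁ t₂ : GroupTriple SL(2, F), IsBeauvilleStructure t₁ t₂ →
      ¬ ∀ g ∈ t₁.members, tr g = 2 ∨ tr g = -1 := by
    intro t₁ t₂ ht hall
    have hns := member_ne_scalar ht.generates₁ ht.mul_eq_one₁
    have hns' := member_ne_scalar ht.generates₂ ht.mul_eq_one₂
    obtain ⟨a, b, ha, hb, hta, htb⟩ : ∃ a b, a ∈ t₁.members ∧ b ∈ t₁.members ∧ tr a = 2 ∧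
        tr b = -1 := by
      have hf := fricke_triple_ne_zero ht.generates₁ ht.mul_eq_one₁
      have hx : t₁.x ∈ t₁.members := by simp [GroupTriple.members]
      have hy : t₁.y ∈ t₁.members := by simp [GroupTriple.members]
      have hz : t₁.z ∈ t₁.members := by simp [GroupTriple.members]
      rcases hall _ hx with h₁ | h₁ <;> rcases hall _ hy with h₂ | h₂
      · rcases hall _ hz with h₃ | h₃
        · rw [h₁, h₂, h₃] at hf
          exact absurd (by norm_num) hf
        · exact ⟨_, _, hx, hz, h₁, h₃⟩
      · exact ⟨_, _, hx, hy, h₁, h₂⟩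
      · exact ⟨_, _, hy, hx, h₂, h₁⟩
      · rcases hall _ hz with h₃ | h₃
        · exact ⟨_, _, hz, hx, h₃, h₁⟩
        · rw [h₁, h₂, h₃] at hf
          exact absurd (by norm_num) hf
    have five : ∀ g ∈ t₂.members, ∀ n : ℕ, (g ^ n) ^ 5 = 1 → g ^ n = 1 := fun g hg n ↦
      pow_eq_one_of_factorization ht fac5 ha hg 1 n
        (by rw [pow_one]; exact unipotent_pow_char a hta 5) (by rw [pow_one]; exact (hns a ha).1)
    have three : ∀ g ∈ t₂.members, ∀ n : ℕ, (g ^ n) ^ 3 = 1 → g ^ n = 1 := fun g hg n ↦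
      pow_eq_one_of_factorization ht fac3 hb hg 1 n
        (by rw [pow_one]; exact cube_eq_one_of_tr htb) (by rw [pow_one]; exact (hns b hb).1)
    refine not_generates_of_tr_zero h2 ht.mul_eq_one₂ (fun g hg ↦ ?_) ht.generates₂
    rcases traces g with htr | htr | htr | htr | htr
    · exact htr
    · have hg2 := three g hg 2 (by rw [← pow_mul, mul_comm, pow_mul, cube_eq_neg_one_of_tr htr]; simp)
      exact absurd hg2 (sq_ne_one_of_tr (by rw [htr]; grind) (by rw [htr]; grind))
    · exact absurd (pow_one g ▸ three g hg 1 (by rw [pow_one, cube_eq_one_of_tr htr])) (hns' g hg).1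
    · exact absurd (pow_one g ▸ five g hg 1 (by rw [pow_one, unipotent_pow_char g htr 5]))
        (hns' g hg).1
    · have hg2 := five g hg 2 (unipotent_pow_char _ (by rw [tr_sq, htr]; norm_num) 5)
      exact absurd (eq_neg_one_of_sq_eq_one h2 hg2 htr) (hns' g hg).2
  rintro ⟨t₁, t₂, ht⟩
  by_cases h₁ : ∀ g ∈ t₁.members, tr g = 2 ∨ tr g = -1
  · exact key t₁ t₂ ht h₁
  by_cases h₂ : ∀ g ∈ t₂.members, tr g = 2 ∨ tr g = -1
  · exact key t₂ t₁ (isBeauvilleStructure_symm ht) h₂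
  push Not at h₁ h₂
  obtain ⟨a, ha, ha₁, ha₂⟩ := h₁
  obtain ⟨b, hb, hb₁, hb₂⟩ := h₂
  obtain ⟨m, hm⟩ := (hneg a).resolve_left (by tauto)
  obtain ⟨n, hn⟩ := (hneg b).resolve_left (by tauto)
  exact pow_ne_pow ht ha hb (neg_one_ne_one h2) hm hn

theorem five_lt_card_of_admits (h : AdmitsBeauvilleStructure SL(2, F)) : 5 < Fintype.card F := by
  by_contra! hle
  have h1 : 1 < Fintype.card F := Fintype.one_lt_card
  interval_cases hc : Fintype.card F
  · exact not_admits_of_card_two hc h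
  · exact not_admits_of_card_three hc h
  · exact not_admits_of_card_four hc h
  · exact not_admits_of_card_five hc h

theorem admitsStronglyReal_of_five_lt_card (hq : 5 < Fintype.card F) :
    AdmitsStronglyRealBeauvilleStructure SL(2, F) := by
  by_cases h2 : (2 : F) = 0
  · exact admitsStronglyReal_of_char_two hq h2
  have hodd : Odd (Fintype.card F) := by
    refine Nat.odd_iff.mpr (FiniteField.odd_card_of_char_ne_two fun hc ↦ h2 ?_)
    have := ringChar.charP F
    rw [hc] at this
    exact CharTwo.two_eq_zero
  by_cases h23 : 23 ≤ Fintype.card F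
  · exact admitsStronglyReal_of_odd_of_large hodd h23
  by_cases h9 : Fintype.card F = 9
  · exact admitsStronglyReal_of_card_nine h9
  apply admitsStronglyReal_of_small_prime
  have hpp : IsPrimePow (Fintype.card F) := FiniteField.isPrimePow_card F
  -- Among the odd numbers from 7 to 21 other than 9, only 15 and 21 are not prime.
  have composite : ∀ a b : ℕ, a.Coprime b → 1 < a → 1 < b → Fintype.card F ≠ a * b := by
    intro a b hab ha hb he
    rw [he] at hpp
    have := (hab.isPrimePow_dvd_mul hpp).mp dvd_rfl
    rcases this with hd | hd
    · have := Nat.le_of_dvd (by omega) hd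
      nlinarith
    · have := Nat.le_of_dvd (by omega) hd
      nlinarith
  have h15 := composite 3 5 (by norm_num) (by norm_num) (by norm_num)
  have h21 := composite 3 7 (by norm_num) (by norm_num) (by norm_num)
  obtain ⟨r, hr⟩ := hodd
  omega

end SpecialLinearTwo

theorem theorem5p1 (F : Type*) [Field F] [Finite F] :
    (AdmitsBeauvilleStructure SL(2, F) ↔ 5 < Nat.card F) ∧
    (5 < Nat.card F → AdmitsStronglyRealBeauvilleStructure SL(2, F)) := by
  have := Fintype.ofFinite F
  rw [Nat.card_eq_fintype_card]
  refine ⟨⟨SpecialLinearTwo.five_lt_card_of_admits, fun h ↦ ?_⟩,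
    SpecialLinearTwo.admitsStronglyReal_of_five_lt_card⟩
  obtain ⟨t₁, t₂, ht⟩ := SpecialLinearTwo.admitsStronglyReal_of_five_lt_card h
  exact ⟨t₁, t₂, ht.toIsBeauvilleStructure⟩
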